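/- Let $F$ be a finite extension of $\mathbb{Q}_p$ and $E$ a finite extension of $F$. Let $(\mathfrak g,\mathfrak b,\mathfrak t)$ be a split reductive Lie algebra over $F$ with a splitting Cartan subalgebra and a Borel subalgebra containing it (for instance the Lie algebras of a connected split reductive group over $F$, a Borel subgroup ${\bf B}$ and a maximal split torus ${\bf T}\subset{\bf B}$). That is: $\mathfrak g$ is a finite-dimensional Lie algebra over $F$ whose radical is its centre; $\mathfrak t\subset\mathfrak g$ is an abelian subalgebra which is its own centralizer and such that $\mathfrak g$ is the sum of the simultaneous eigenspaces $\mathfrak g_\alpha$ ($\alpha\in\mathfrak t^*$) of $\mathfrak t$; with $\Phi=\{\alpha\neq 0 : \mathfrak g_\alpha\ne 0\}$ and $\Phi^+=\{\alpha\in\Phi : \mathfrak g_\alpha\subset\mathfrak b\}$, the subalgebra $\mathfrak b$ equals $\mathfrak t\oplus\bigoplus_{\alpha\in\Phi^+}\mathfrak g_\alpha$, and $\Phi$ is the disjoint union of $\Phi^+$ and $-\Phi^+$. Put $\rho=\frac12\sum_{\alpha\in\Phi^+}\alpha$, let a subscript $E$ denote base change to $E$, and write $U=U(\mathfrak g_E)$.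 For $\mu\in\mathfrak t_E^*=\mathrm{Hom}_F(\mathfrak t,E)$ let $E_\mu$ be the one-dimensional left (respectively right) $U(\mathfrak b_E)$-module on which $x\in\mathfrak b_E$ acts as multiplication by $\mu(\bar x)$, where $x\mapsto\bar x$ is the quotient morphism $\mathfrak b_E\to\mathfrak t_E$ that is the identity on $\mathfrak t_E$ and zero on $\mathfrak g_{\alpha,E}$ for $\alpha\in\Phi^+$; and let $M(\mu)=U\otimes_{U(\mathfrak b_E)}E_\mu$ be the Verma module of highest weight $\mu$. For a right $U$-module $N$ let ${}_\ell N$ be the left $U$-module $N$ with $u.n=n.\iota(u)$, where $\iota$ is the anti-automorphism of $U$ with $\iota(x)=-x$ for $x\in\mathfrak g_E$. For a left $U$-module $M$, $\mathrm{RHom}_U(M,U)$ and $\mathrm{Ext}^i_U(M,U)$ carry the right $U$-module structure induced by right multiplication on $U$. Then for every $\lambda\in\mathfrak t_E^*$ there is an isomorphism in the derived category of right $U$-modules $$\mathrm{RHom}_U(M(\lambda),U)\;\cong\;\bigl(E_{\lambda+2\rho}\otimes_{U(\mathfrak b_E)}U\bigr)[-\dim_F\mathfrak b],$$ and an isomorphism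 in the derived category of left $U$-modules $${}_\ell\mathrm{RHom}_U(M(\lambda),U)\;\cong\;M(-\lambda-2\rho)[-\dim_F\mathfrak b].$$ In particular, as left $U$-modules, ${}_\ell\mathrm{Ext}^i_U(M(\lambda),U)\cong M(-\lambda-2\rho)$ for $i=\dim_F\mathfrak b$, and $\mathrm{Ext}^i_U(M(\lambda),U)=0$ for $i\neq\dim_F\mathfrak b$. -/

import Mathlib

open scoped TensorProduct
open CategoryTheory

noncomputable section

namespace VermaDuality

attribute [local instance 100] LieRing.ofAssociativeRing

/-! ### Split reductive Lie algebras and Borel subalgebras -/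

section Roots

variable {F g : Type*} [Field F] [LieRing g] [LieAlgebra F g]

/-- The root space `g_α = {x ∈ g | [h, x] = α(h) x for all h ∈ t}`. -/
def rootSpace (t : LieSubalgebra F g) (α : Module.Dual F t) : Submodule F g :=
  (LieModule.weightSpace g (α : t → F)).toSubmodule

theorem mem_rootSpace {t : LieSubalgebra F g} {α : Module.Dual F t} {x : g} :
    x ∈ rootSpace t α ↔ ∀ h : t, ⁅(h : g), x⁆ = α h • x :=
  LieModule.mem_weightSpace _ _

/-- The set `Φ = Φ(g, t)` of roots. -/
def roots (t : LieSubalgebra F g) : Set (Module.Dual F t) :=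
  {α | α ≠ 0 ∧ rootSpace t α ≠ ⊥}

/-- The set `Φ⁺` of roots determined by `b`, i.e. those `α ∈ Φ` with `g_α ⊆ b`. -/
def posRoots (t b : LieSubalgebra F g) : Set (Module.Dual F t) :=
  {α | α ∈ roots t ∧ rootSpace t α ≤ b.toSubmodule}

/-- `ρ`, half the sum of the positive roots. (There are finitely many roots when `g` is
finite-dimensional, see `roots_finite`.) -/
def rho (t b : LieSubalgebra F g) : Module.Dual F t :=
  (2 : F)⁻¹ • ∑ᶠ α ∈ posRoots t b, α

/-- `t` is a splitting Cartan subalgebra (the Lie algebra of a maximal split torus when `g` is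
split reductive): it is abelian, equal to its own centralizer, and `g` is the sum of the
simultaneous eigenspaces of `t`. -/
structure IsSplittingCartan (t : LieSubalgebra F g) : Prop where
  lie_eq_zero : ∀ x ∈ t, ∀ y ∈ t, ⁅x, y⁆ = 0
  mem_of_centralizes : ∀ x : g, (∀ h ∈ t, ⁅h, x⁆ = 0) → x ∈ t
  iSup_rootSpace : ⨆ α : Module.Dual F t, rootSpace t α = ⊤

/-- The Lie subalgebra `b` is a Borel subalgebra containing the splitting Cartan subalgebra `t`:
`b = t ⊕ ⨁_{α ∈ Φ⁺} g_α`, where `Φ` is the disjoint union of `Φ⁺` and `-Φ⁺`. -/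
structure IsBorel (t b : LieSubalgebra F g) : Prop where
  eq_sup : b.toSubmodule = t.toSubmodule ⊔ ⨆ α ∈ posRoots t b, rootSpace t α
  pos_xor_neg : ∀ α ∈ roots t, Xor (α ∈ posRoots t b) (-α ∈ posRoots t b)

variable {t b : LieSubalgebra F g}

theorem IsSplittingCartan.isLieAbelian (ht : IsSplittingCartan t) : IsLieAbelian t :=
  ⟨fun x y => Subtype.ext (ht.lie_eq_zero x x.2 y y.2)⟩

theorem iSupIndep_rootSpace (ht : IsSplittingCartan t) : iSupIndep (rootSpace t) := by
  have := ht.isLieAbelian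
  have h := LieSubmodule.iSupIndep_toSubmodule.mpr (LieModule.iSupIndep_genWeightSpace F t g)
  have h' := h.comp (f := fun α : Module.Dual F t => (α : t → F)) DFunLike.coe_injective
  exact h'.mono fun α => LieModule.weightSpace_le_genWeightSpace g (α : t → F)

theorem roots_finite [FiniteDimensional F g] (ht : IsSplittingCartan t) : (roots t).Finite :=
  (WellFoundedGT.finite_ne_bot_of_iSupIndep (iSupIndep_rootSpace ht)).subset fun _ h => h.2

theorem rootSpace_zero (ht : IsSplittingCartan t) : rootSpace t 0 = t.toSubmodule := by
  ext x
  rw [mem_rootSpace]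
  simp only [LinearMap.zero_apply, zero_smul]
  exact ⟨fun h => ht.mem_of_centralizes x fun y hy => h ⟨y, hy⟩,
    fun h y => ht.lie_eq_zero y y.2 x h⟩

/-- The root decomposition `g = t ⊕ ⨁_{α ∈ Φ} g_α`. -/
theorem isCompl_roots (ht : IsSplittingCartan t) :
    IsCompl t.toSubmodule (⨆ α ∈ roots t, rootSpace t α) := by
  have key : (⨆ α ∈ roots t, rootSpace t α) = ⨆ α, ⨆ (_ : α ≠ 0), rootSpace t α := by
    apply le_antisymm
    · exact iSup_mono fun α => iSup_le fun h => le_iSup_of_le h.1 le_rfl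
    · refine iSup_mono fun α => iSup_le fun h => ?_
      by_cases h0 : rootSpace t α = ⊥
      · rw [h0]; exact bot_le
      · exact le_iSup_of_le (show α ∈ roots t from ⟨h, h0⟩) le_rfl
  rw [key, ← rootSpace_zero ht]
  refine ⟨iSupIndep_rootSpace ht 0, codisjoint_iff.mpr ?_⟩
  rw [eq_top_iff, ← ht.iSup_rootSpace]
  refine iSup_le fun α => ?_
  by_cases h : α = 0
  · subst h; exact le_sup_left
  · exact le_sup_of_le_right (le_iSup_of_le α (le_iSup_of_le h le_rfl))

/-- The projection `g → t` along `⨁_{α ∈ Φ} g_α`. -/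
def cartanProj (ht : IsSplittingCartan t) : g →ₗ[F] t :=
  t.toSubmodule.projectionOnto _ (isCompl_roots ht)

theorem cartanProj_of_mem (ht : IsSplittingCartan t) {x : g} (hx : x ∈ t) :
    cartanProj ht x = ⟨x, hx⟩ :=
  Submodule.projectionOnto_apply_left (isCompl_roots ht) ⟨x, hx⟩

theorem cartanProj_of_mem_rootSpace (ht : IsSplittingCartan t) {α : Module.Dual F t}
    (hα : α ≠ 0) {x : g} (hx : x ∈ rootSpace t α) : cartanProj ht x = 0 := by
  by_cases h0 : x = 0
  · rw [h0, map_zero]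
  · refine Submodule.projectionOnto_apply_of_mem_right (isCompl_roots ht) ?_
    have : α ∈ roots t := ⟨hα, fun h => h0 (by rw [h] at hx; simpa using hx)⟩
    exact Submodule.mem_iSup_of_mem α (Submodule.mem_iSup_of_mem this hx)

theorem lie_mem_rootSpace {α β : Module.Dual F t} {x y : g} (hx : x ∈ rootSpace t α)
    (hy : y ∈ rootSpace t β) : ⁅x, y⁆ ∈ rootSpace t (α + β) := by
  rw [mem_rootSpace] at *
  intro h
  rw [leibniz_lie, hx h, hy h, smul_lie, lie_smul, LinearMap.add_apply, add_smul]

theorem cartanProj_lie (ht : IsSplittingCartan t) (hb : IsBorel t b) {x y : g} (hx : x ∈ b)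
    (hy : y ∈ b) : cartanProj ht ⁅x, y⁆ = 0 := by
  let P : Set (Module.Dual F t) := insert 0 (posRoots t b)
  have hbP : b.toSubmodule = ⨆ α ∈ P, rootSpace t α := by
    rw [iSup_insert, rootSpace_zero ht]; exact hb.eq_sup
  have main : ∀ α ∈ P, ∀ β ∈ P, ∀ u ∈ rootSpace t α, ∀ v ∈ rootSpace t β,
      cartanProj ht ⁅u, v⁆ = 0 := by
    intro α hα β hβ u hu v hv
    by_cases h : α + β = 0
    · rcases hα with rfl | hα
      · have hβ0 : β = 0 := by simpa using h
        subst hβ0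
        rw [rootSpace_zero ht] at hu hv
        rw [ht.lie_eq_zero u hu v hv, map_zero]
      · have hβα : β = -α := (neg_eq_of_add_eq_zero_right h).symm
        rcases hβ with rfl | hβ
        · exact absurd (by simpa using h) hα.1.1
        · rcases hb.pos_xor_neg α hα.1 with h1 | h1
          · exact absurd (hβα ▸ hβ) h1.2
          · exact absurd hα h1.2
    · exact cartanProj_of_mem_rootSpace ht h (lie_mem_rootSpace hu hv)
  have hx' : x ∈ ⨆ α ∈ P, rootSpace t α := hbP ▸ hx
  have hy' : y ∈ ⨆ α ∈ P, rootSpace t α := hbP ▸ hy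
  have hx2 : ∀ β ∈ P, ∀ v ∈ rootSpace t β, cartanProj ht ⁅x, v⁆ = 0 := by
    intro β hβ v hv
    have : (⨆ α ∈ P, rootSpace t α) ≤
        LinearMap.ker ((cartanProj ht) ∘ₗ (LieModule.toEnd F g g).toLinearMap.flip v) :=
      iSup₂_le fun α hα u hu => main α hα β hβ u hu v hv
    exact this hx'
  have : (⨆ α ∈ P, rootSpace t α) ≤
      LinearMap.ker ((cartanProj ht) ∘ₗ (LieModule.toEnd F g g x)) :=
    iSup₂_le fun β hβ v hv => hx2 β hβ v hv
  exact this hy'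

/-- The quotient morphism `b → t`: the identity on `t`, and zero on `g_α` for `α ∈ Φ⁺`. -/
def borelToCartan (ht : IsSplittingCartan t) (hb : IsBorel t b) : b →ₗ⁅F⁆ t where
  toLinearMap := cartanProj ht ∘ₗ b.toSubmodule.subtype
  map_lie' {x y} := by
    have h1 : cartanProj ht ⁅(x : g), (y : g)⁆ = 0 := cartanProj_lie ht hb x.2 y.2
    have := ht.isLieAbelian
    exact h1.trans (trivial_lie_zero t t _ _).symm

end Roots

/-! ### Universal enveloping algebras -/

section Enveloping

variable (R : Type*) {L L' : Type*} [CommRing R] [LieRing L] [LieAlgebra R L] [LieRing L']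
  [LieAlgebra R L']

/-- The algebra morphism `U(L) → U(L')` induced by a morphism of Lie algebras `L → L'`. -/
def envMap (f : L →ₗ⁅R⁆ L') :
    UniversalEnvelopingAlgebra R L →ₐ[R] UniversalEnvelopingAlgebra R L' :=
  UniversalEnvelopingAlgebra.lift R ((UniversalEnvelopingAlgebra.ι R).comp f)

variable (L) in
/-- The principal anti-automorphism of `U(L)`, `x ↦ -x` for `x ∈ L`, as an algebra morphism from
`U(L)` to its opposite algebra. -/
def antipode : UniversalEnvelopingAlgebra R L →ₐ[R] (UniversalEnvelopingAlgebra R L)ᵐᵒᵖ :=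
  UniversalEnvelopingAlgebra.lift R
    { toFun x := MulOpposite.op (-(UniversalEnvelopingAlgebra.ι R x))
      map_add' x y := by simp [add_comm]
      map_smul' c x := by simp
      map_lie' {x y} := by
        rw [LieRing.of_associative_ring_bracket, LieHom.map_lie,
          LieRing.of_associative_ring_bracket, ← MulOpposite.op_mul, ← MulOpposite.op_mul,
          ← MulOpposite.op_sub]
        congr 1
        noncomm_ring }

/-- Extension of scalars for morphisms of Lie algebras. -/
def lieBaseChange {F g h : Type*} (E : Type*) [CommRing F] [CommRing E] [Algebra F E] [LieRing g]
    [LieAlgebra F g] [LieRing h] [LieAlgebra F h] (f : g →ₗ⁅F⁆ h) :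
    E ⊗[F] g →ₗ⁅E⁆ E ⊗[F] h where
  toLinearMap := (f : g →ₗ[F] h).baseChange E
  map_lie' {x y} := (LieAlgebra.ExtendScalars.map (AlgHom.id F E) f).map_lie x y

/-- For an abelian Lie algebra `t` over `F` and `μ ∈ Hom_F(t, E)`, the corresponding
character of the Lie algebra `t_E = E ⊗ t`. -/
def abelianCharacter {F t E : Type*} [CommRing F] [CommRing E] [Algebra F E] [LieRing t]
    [LieAlgebra F t] [IsLieAbelian t] (μ : t →ₗ[F] E) : E ⊗[F] t →ₗ⁅E⁆ E where
  toLinearMap := μ.liftBaseChange E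
  map_lie' {x y} := by
    have h : ⁅x, y⁆ = 0 := by
      induction x with
      | zero => simp
      | add a b ha hb => rw [add_lie, ha, hb, add_zero]
      | tmul a u =>
        induction y with
        | zero => simp
        | add a b ha hb => rw [lie_add, ha, hb, add_zero]
        | tmul b v =>
          rw [LieAlgebra.ExtendScalars.bracket_tmul, trivial_lie_zero, TensorProduct.tmul_zero]
    rw [h, LieRing.of_associative_ring_bracket, mul_comm, sub_self]
    exact map_zero _

end Enveloping

/-! ### Induced modules over noncommutative algebras -/

section Induced

variable {k A B : Type*} [CommRing k] [Ring A] [Algebra k A] [Ring B] [Algebra k B]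

/-- The module `k_χ`: the base ring `k` on which `a ∈ A` acts as multiplication by `χ(a)`. -/
@[nolint unusedArguments]
def CharModule (_χ : A →ₐ[k] k) : Type _ := k

instance (χ : A →ₐ[k] k) : AddCommGroup (CharModule χ) := inferInstanceAs (AddCommGroup k)

instance (χ : A →ₐ[k] k) : Module k (CharModule χ) := inferInstanceAs (Module k k)

instance (χ : A →ₐ[k] k) : Module A (CharModule χ) := Module.compHom k χ.toRingHom

theorem charModule_smul (χ : A →ₐ[k] k) (a : A) (c : k) :
    (a • (show CharModule χ from c) : CharModule χ) = (show CharModule χ from χ a * c) := rfl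

instance (χ : A →ₐ[k] k) : IsScalarTower k A (CharModule χ) where
  smul_assoc c a x := by
    change χ (c • a) * (show k from x) = c * (χ a * (show k from x))
    rw [map_smul, smul_eq_mul, mul_assoc]

/-- The submodule of `B ⊗_k W` generated by the elements `b φ(a) ⊗ w - b ⊗ a w`. -/
def balancing (φ : A →ₐ[k] B) (W : Type*) [AddCommGroup W] [Module k W] [Module A W] :
    Submodule B (B ⊗[k] W) :=
  Submodule.span B {z | ∃ (b : B) (a : A) (w : W), z = (b * φ a) ⊗ₜ[k] w - b ⊗ₜ[k] (a • w)}

/-- For a morphism `φ : A → B` of `k`-algebras and a left `A`-module `W`, the left `B`-module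
`B ⊗_A W`, as the quotient of `B ⊗_k W` by the relations `b φ(a) ⊗ w = b ⊗ a w`. -/
abbrev Induced (φ : A →ₐ[k] B) (W : Type*) [AddCommGroup W] [Module k W] [Module A W] : Type _ :=
  (B ⊗[k] W) ⧸ balancing φ W

/-- For a right `A`-module `N`, the right `B`-module `N ⊗_A B`. Right modules are left modules
over the opposite algebra, and `n ⊗ b` is the class of `b ⊗ n` in the induced module for
`Aᵐᵒᵖ → Bᵐᵒᵖ`; the relations read `n ⊗ φ(a) b = n a ⊗ b`. -/
abbrev RightInduced (φ : A →ₐ[k] B) (N : Type*) [AddCommGroup N] [Module k N]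
    [Module Aᵐᵒᵖ N] : Type _ :=
  Induced (AlgHom.op φ) N

/-- The right `A`-module `k_χ`, with `c a = c χ(a)`. -/
abbrev RightCharModule (χ : A →ₐ[k] k) : Type _ :=
  CharModule (χ.fromOpposite fun x y => Commute.all (χ x) (χ y))

end Induced

/-! ### Verma modules -/

section Verma

variable {F g : Type*} [Field F] [LieRing g] [LieAlgebra F g] (E : Type*) [Field E] [Algebra F E]

variable (F g) in
/-- `U(g_E)`, for `g_E = E ⊗_F g`. -/
abbrev U : Type _ := UniversalEnvelopingAlgebra E (E ⊗[F] g)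

variable {E} {t b : LieSubalgebra F g}

variable (E b) in
/-- The morphism `U(b_E) → U(g_E)` induced by the inclusion of `b` into `g`. -/
def inclU : UniversalEnvelopingAlgebra E (E ⊗[F] b) →ₐ[E] U F g E :=
  envMap E (lieBaseChange E b.incl)

/-- The character of `U(b_E)` given by `μ ∈ t_E^* = Hom_F(t, E)`, through the quotient morphism
`b_E → t_E`. -/
def borelCharacter (ht : IsSplittingCartan t) (hb : IsBorel t b) (μ : t →ₗ[F] E) :
    UniversalEnvelopingAlgebra E (E ⊗[F] b) →ₐ[E] E :=
  have := ht.isLieAbelian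
  UniversalEnvelopingAlgebra.lift E
    ((abelianCharacter μ).comp (lieBaseChange E (borelToCartan ht hb)))

/-- The Verma module `M(μ) = U(g_E) ⊗_{U(b_E)} E_μ`. -/
abbrev Verma (ht : IsSplittingCartan t) (hb : IsBorel t b) (μ : t →ₗ[F] E) : Type _ :=
  Induced (inclU E b) (CharModule (borelCharacter ht hb μ))

/-- The right `U(g_E)`-module `E_μ ⊗_{U(b_E)} U(g_E)`. -/
abbrev RightVerma (ht : IsSplittingCartan t) (hb : IsBorel t b) (μ : t →ₗ[F] E) : Type _ :=
  RightInduced (inclU E b) (RightCharModule (borelCharacter ht hb μ))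

variable (E t b) in
/-- `ρ` as an element of `t_E^* = Hom_F(t, E)`. -/
def rhoE : t →ₗ[F] E := Algebra.linearMap F E ∘ₗ rho t b

end Verma

/-! ### `RHom_A(-, A)` and `Ext_A(-, A)` -/

section Duality

universe u

variable (A : Type u) [Ring A]

/-- The functor `Hom_A(-, A)` from left `A`-modules to right `A`-modules; the right action is
`(f a)(m) = f(m) a`. -/
def dualFunctor : (ModuleCat.{u} A)ᵒᵖ ⥤ ModuleCat.{u} Aᵐᵒᵖ where
  obj M := ModuleCat.of Aᵐᵒᵖ (M.unop →ₗ[A] A)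
  map f := ModuleCat.ofHom
    { toFun := fun φ => φ ∘ₗ f.unop.hom
      map_add' := fun _ _ => rfl
      map_smul' := fun _ _ => rfl }

instance : (dualFunctor A).Additive where
  map_add {M _ f g} := ModuleCat.hom_ext <| LinearMap.ext fun φ =>
    LinearMap.comp_add f.unop.hom g.unop.hom (show M.unop →ₗ[A] A from φ)

variable {A}

/-- The cochain complex `Hom_A(P, A)` of right `A`-modules, in degrees `≥ 0`, for a chain complex
`P` of left `A`-modules. -/
def dualComplex (P : ChainComplex (ModuleCat.{u} A) ℕ) :
    CochainComplex (ModuleCat.{u} Aᵐᵒᵖ) ℕ :=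
  (((dualFunctor A).rightOp.mapHomologicalComplex _).obj P).unop

/-- `RHom_A(M, A)` as an object of the derived category of right `A`-modules, computed by a
projective resolution `P` of the left `A`-module `M`. -/
def RHom [HasDerivedCategory (ModuleCat.{u} Aᵐᵒᵖ)] {M : ModuleCat.{u} A}
    (P : ProjectiveResolution M) : DerivedCategory (ModuleCat.{u} Aᵐᵒᵖ) :=
  DerivedCategory.Q.obj ((dualComplex P.complex).extend ComplexShape.embeddingUpNat)

/-- The endomorphism `x ↦ x a` of the left `A`-module `A`. -/
def rightMul (a : A) : ModuleCat.of A A ⟶ ModuleCat.of A A :=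
  ModuleCat.ofHom (LinearMap.toSpanSingleton A A a)

/-- The right `A`-module structure on `Ext^i_A(M, A)`: `a ∈ A` acts through the endomorphism
`x ↦ x a` of the left `A`-module `A`. -/
instance extRightModule (M : ModuleCat.{u} A) (i : ℕ) :
    Module Aᵐᵒᵖ (Abelian.Ext M (ModuleCat.of A A) i) where
  smul a x := x.comp (Abelian.Ext.mk₀ (rightMul a.unop)) (add_zero i)
  one_smul x := by
    have h : rightMul (1 : A) = 𝟙 _ := by
      ext; simp [rightMul]
    change x.comp (Abelian.Ext.mk₀ (rightMul 1)) _ = x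
    rw [h, Abelian.Ext.comp_mk₀_id]
  mul_smul a b x := by
    have h : rightMul (b.unop * a.unop) = rightMul b.unop ≫ rightMul a.unop := by
      ext; simp [rightMul]
    change x.comp (Abelian.Ext.mk₀ (rightMul (b.unop * a.unop))) _ =
      (x.comp (Abelian.Ext.mk₀ (rightMul b.unop)) _).comp
        (Abelian.Ext.mk₀ (rightMul a.unop)) _
    rw [h, ← Abelian.Ext.mk₀_comp_mk₀, Abelian.Ext.comp_assoc_of_third_deg_zero]
  smul_zero a := by
    change (0 : Abelian.Ext M (ModuleCat.of A A) i).comp (Abelian.Ext.mk₀ (rightMul a.unop)) _ = 0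
    rw [Abelian.Ext.zero_comp]
  smul_add a x y := Abelian.Ext.add_comp x y (Abelian.Ext.mk₀ (rightMul a.unop)) (add_zero i)
  add_smul a b x := by
    have h : rightMul (a.unop + b.unop) = rightMul a.unop + rightMul b.unop := by
      ext; simp [rightMul]
    change x.comp (Abelian.Ext.mk₀ (rightMul (a.unop + b.unop))) _ = _
    rw [h, Abelian.Ext.mk₀_add, Abelian.Ext.comp_add]
    rfl
  zero_smul x := by
    have h : rightMul (0 : A) = 0 := by
      ext; simp [rightMul]
    change x.comp (Abelian.Ext.mk₀ (rightMul 0)) _ = 0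
    rw [h, Abelian.Ext.mk₀_zero, Abelian.Ext.comp_zero]

/-- `Ext^i_A(M, A)` as a right `A`-module. -/
abbrev extRight (M : ModuleCat.{u} A) (i : ℕ) : ModuleCat.{u} Aᵐᵒᵖ :=
  ModuleCat.of Aᵐᵒᵖ (Abelian.Ext M (ModuleCat.of A A) i)

end Duality

/-! ### Right modules as left modules -/

section LeftOfRight

universe v

instance {R S : Type*} [Ring R] [Ring S] (f : R →+* S) :
    Limits.PreservesFiniteLimits (ModuleCat.restrictScalars.{v} f) where
  preservesFiniteLimits _ _ _ := { preservesLimit := inferInstance }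

variable (R L : Type*) [CommRing R] [LieRing L] [LieAlgebra R L]

/-- The functor `N ↦ ₗN` from right to left `U(L)`-modules, where `u n = n ι(u)` for the principal
anti-automorphism `ι`. -/
abbrev leftOfRight : ModuleCat.{v} (UniversalEnvelopingAlgebra R L)ᵐᵒᵖ ⥤
    ModuleCat.{v} (UniversalEnvelopingAlgebra R L) :=
  ModuleCat.restrictScalars (antipode R L).toRingHom

end LeftOfRight

end VermaDuality

end

open VermaDuality

/-! The Verma module is `U/J`, where the left ideal `J` is generated by the elements `y - λ(y)` for
`y` in a basis of the Borel subalgebra. The proof builds `U/J` by dividing out one generator at a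
time, as in a noncommutative Koszul complex, and keeps track of how the generators act on Ext.

The basis `y 0, …, y (n-1)` from `exists_adapted_basis` consists of root vectors, higher roots
first, followed by a basis of the Cartan subalgebra, so that initial segments span ideals of `b`.
With `x j = y j - λ(y j)` and `J i` the left ideal of the first `i` generators, right multiplication
by `x i` is an injective endomorphism of `U/J i` with cokernel `U/J (i+1)`. If Ext of `U/J i` is a
cyclic right module `U/R` in degree `i`, the long exact sequence makes Ext of `U/J (i+1)` cyclic in
degree `i+1`, provided the operator induced on `U/R` is injective (`DualCyclic.step`). That operator
is not left multiplication by `x i` itself. Moving `x a` past `x l` costs the weight `γ a l` of `y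
a` on the `l`-th quotient of the chain of ideals, so `x a` acts as `x a` minus a partial trace of
`ad (y a)` (`dualCyclic_leftSpan`). These traces add up to `2ρ`, which turns `λ` into `λ + 2ρ`;
passing to left modules by the antipode changes the sign.

The regularity used on both sides comes from a basis of ordered monomials. In characteristic zero,
divided convolution powers of a linear map to a polynomial ring prove their independence
(`linearIndepOn_orderedMon`), once the Lie algebra embeds in its enveloping algebra. For a reductive
algebra the embedding follows from the adjoint representation together with characters that separate
the centre (`exists_character_eq_on_ker`). Ordering the positive roots rests on
`sum_posRoots_ne_zero`, an `sl₂` argument in the quotient by the centre.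

Finally, a complex with cohomology in a single degree is determined by that cohomology in the
derived category, so the statement about Ext gives the one about RHom. -/

noncomputable section

namespace VermaDuality

/-! ### `Ext_A(A/J, A)` for left ideals generated by a regular sequence -/

section KoszulExt

universe u

open Abelian MulOpposite

variable {A : Type u} [Ring A]

/-- Right multiplication by `a`, as a morphism `A/J ⟶ A/K` for left ideals with `J a ⊆ K`. -/
def quotMulRight (J K : Submodule A A) (a : A) (h : ∀ u ∈ J, u * a ∈ K) :
    ModuleCat.of A (A ⧸ J) ⟶ ModuleCat.of A (A ⧸ K) :=
  ModuleCat.ofHom (J.mapQ K (LinearMap.toSpanSingleton A A a) h)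

theorem op_smul_ext {M : ModuleCat.{u} A} {i : ℕ} (a : A) (ξ : Ext M (ModuleCat.of A A) i) :
    op a • ξ = ξ.comp (Ext.mk₀ (rightMul a)) (add_zero i) := rfl

theorem comp_op_smul_ext {M N : ModuleCat.{u} A} {i j k : ℕ} (a : A) (α : Ext M N i)
    (ξ : Ext N (ModuleCat.of A A) j) (h : i + j = k) :
    α.comp (op a • ξ) h = op a • α.comp ξ h := by
  rw [op_smul_ext, op_smul_ext, Ext.comp_assoc_of_third_deg_zero]

/-- `Ext_A(M, A)` is concentrated in degree `n`, where it is generated as a right `A`-module by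
an element with annihilator `R`, on which an endomorphism `φ` of `M` acts as right multiplication
by `z` whenever `D φ z`. -/
def DualCyclic (M : ModuleCat.{u} A) (n : ℕ) (R : Submodule Aᵐᵒᵖ A) (D : (M ⟶ M) → A → Prop) :
    Prop :=
  (∀ i, i ≠ n → Subsingleton (Ext M (ModuleCat.of A A) i)) ∧
  ∃ e : Ext M (ModuleCat.of A A) n,
    (∀ ξ, ∃ a : A, op a • e = ξ) ∧ (∀ a : A, op a • e = 0 ↔ a ∈ R) ∧
    ∀ φ z, D φ z → (Ext.mk₀ φ).comp e (zero_add n) = op z • e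

/-- Start of the induction: the module is free of rank one, and its dual is generated by the
identification with `A`. -/
theorem dualCyclic_of_eq_bot {J : Submodule A A} (hJ : J = ⊥) :
    DualCyclic (ModuleCat.of A (A ⧸ J)) 0 ⊥
      (fun φ z => φ.hom (Submodule.Quotient.mk 1) = Submodule.Quotient.mk z) := by
  let E : (A ⧸ J) ≃ₗ[A] A := Submodule.quotEquivOfEqBot J hJ
  have hproj : Projective (ModuleCat.of A (A ⧸ J)) := by
    have : Module.Projective A (A ⧸ J) := Module.Projective.of_equiv E.symm
    exact (IsProjective.iff_projective _).1 this
  refine ⟨fun i hi => ?_, Ext.mk₀ (ModuleCat.ofHom E.toLinearMap), fun ξ => ?_, fun a => ?_, ?_⟩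
  · obtain ⟨i, rfl⟩ := Nat.exists_eq_succ_of_ne_zero hi
    exact subsingleton_of_forall_eq 0 fun ξ => ξ.eq_zero_of_projective
  · obtain ⟨f, rfl⟩ := Ext.addEquiv₀.symm.surjective ξ
    refine ⟨f.hom (Submodule.Quotient.mk 1), ?_⟩
    rw [op_smul_ext, Ext.mk₀_comp_mk₀, Ext.addEquiv₀_symm_apply]
    congr 1
    ext
    change E (Submodule.Quotient.mk 1) • f.hom (Submodule.Quotient.mk 1) = _
    rw [Submodule.quotEquivOfEqBot_apply_mk, one_smul]
    rfl
  · rw [op_smul_ext, Ext.mk₀_comp_mk₀, Ext.mk₀_eq_zero_iff, Submodule.mem_bot]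
    constructor
    · intro h
      have := congrArg (fun f => f.hom (Submodule.Quotient.mk 1)) h
      change E (Submodule.Quotient.mk 1) • a = 0 at this
      rwa [Submodule.quotEquivOfEqBot_apply_mk, one_smul] at this
    · rintro rfl
      ext
      change E (Submodule.Quotient.mk 1) • (0 : A) = 0
      rw [smul_zero]
  · intro φ z h
    rw [op_smul_ext, Ext.mk₀_comp_mk₀, Ext.mk₀_comp_mk₀]
    congr 1
    ext
    change E (φ.hom (Submodule.Quotient.mk 1)) = E (Submodule.Quotient.mk 1) • z
    rw [h, Submodule.quotEquivOfEqBot_apply_mk, Submodule.quotEquivOfEqBot_apply_mk, one_smul]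

/-- In the long exact sequence of `Ext(-, A)`, the map induced by `f` is left multiplication by `x'`
on `A/R`. It is injective by `hreg'`, and its cokernel is `A/S` since `S = R + x'A`. The new
generator is the image of the old one under the connecting map. An endomorphism of `N` that lifts to
the whole sequence acts on this generator through the lift to the first term. -/
theorem DualCyclic.step {M N : ModuleCat.{u} A} {f : M ⟶ M} {g : M ⟶ N} {w : f ≫ g = 0}
    (hT : (ShortComplex.mk f g w).ShortExact) {n : ℕ} {R S : Submodule Aᵐᵒᵖ A}
    {D : (M ⟶ M) → A → Prop} {D' : (N ⟶ N) → A → Prop} {x' : A}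
    (H : DualCyclic M n R D) (hD : D f x') (hreg' : ∀ u, x' * u ∈ R → u ∈ R)
    (hRS : R ≤ S) (hx'S : x' ∈ S) (hS : ∀ v ∈ S, ∃ u, v - x' * u ∈ R)
    (hD' : ∀ ψ z, D' ψ z → ∃ φ₁ φ₂ : M ⟶ M, D φ₁ z ∧ φ₁ ≫ f = f ≫ φ₂ ∧ φ₂ ≫ g = g ≫ ψ) :
    DualCyclic N (n + 1) S D' := by
  obtain ⟨hvan, e, hsurj, hker, hact⟩ := H
  have hcomp : ∀ a : A, (Ext.mk₀ f).comp (op a • e) (zero_add n) = op (x' * a) • e := by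
    intro a
    rw [comp_op_smul_ext, hact f x' hD, smul_smul, ← op_mul]
  have hepi : Epi g := hT.epi_g
  have hzero : ∀ i, i ≠ n → ∀ ξ : Ext M (ModuleCat.of A A) i, ξ = 0 := fun i hi ξ =>
    (hvan i hi).elim _ _
  have hvan' : ∀ i, i ≠ n + 1 → ∀ ξ : Ext N (ModuleCat.of A A) i,
      (Ext.mk₀ g).comp ξ (zero_add i) = 0 → ξ = 0 := by
    intro i hi ξ h0
    rcases Nat.eq_zero_or_pos i with rfl | hpos
    · refine Ext.precomp_mk₀_injective_of_epi (ModuleCat.of A A) g ?_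
      change (Ext.mk₀ g).comp ξ (zero_add 0) = (Ext.mk₀ g).comp 0 (zero_add 0)
      rw [h0, Ext.comp_zero]
    · obtain ⟨η, rfl⟩ := Ext.contravariant_sequence_exact₃ hT _ ξ h0 (n₀ := i - 1) (by omega)
      rw [hzero (i - 1) (by omega) η, Ext.comp_zero]
  refine ⟨fun i hi => subsingleton_of_forall_eq 0 fun ξ => hvan' i hi ξ ?_,
    hT.extClass.comp e (add_comm 1 n), fun ξ => ?_, fun a => ?_, ?_⟩
  -- Only degree `n` needs an argument: there the pullback of `ξ` along `g` is killed by `f`, which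
  -- acts injectively.
  · by_cases hin : i = n
    · subst hin
      obtain ⟨a, ha⟩ := hsurj ((Ext.mk₀ g).comp ξ (zero_add i))
      have h0 : (Ext.mk₀ f).comp (op a • e) (zero_add i) = 0 := by
        rw [ha, Ext.mk₀_comp_mk₀_assoc, w, Ext.mk₀_zero, Ext.zero_comp]
      rw [hcomp, hker] at h0
      rw [← ha, (hker a).2 (hreg' a h0)]
    · exact hzero i hin _
  · obtain ⟨η, hη⟩ := Ext.contravariant_sequence_exact₃ hT _ ξ (hzero _ (by omega) _)
      (add_comm 1 n)
    obtain ⟨a, rfl⟩ := hsurj η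
    exact ⟨a, by rw [← hη, comp_op_smul_ext]⟩
  · rw [← comp_op_smul_ext]
    constructor
    · intro h
      obtain ⟨η, hη⟩ := Ext.contravariant_sequence_exact₁ hT _ (op a • e) (add_comm 1 n) h
      obtain ⟨b, rfl⟩ := hsurj η
      change (Ext.mk₀ f).comp (op b • e) (zero_add n) = op a • e at hη
      rw [hcomp, eq_comm, ← sub_eq_zero, ← sub_smul, ← MulOpposite.op_sub, hker] at hη
      have := S.add_mem (hRS hη) (S.smul_mem (op b) hx'S)
      simpa using this
    · intro ha
      obtain ⟨b, hb⟩ := hS a ha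
      have h1 : op a • e = op (x' * b) • e := by
        rw [← sub_eq_zero, ← sub_smul, ← MulOpposite.op_sub, hker]
        exact hb
      rw [h1, ← hcomp]
      exact ShortComplex.ShortExact.extClass_comp_assoc hT _
  · intro ψ z hz
    obtain ⟨φ₁, φ₂, hφ, h₁, h₂⟩ := hD' ψ z hz
    have hnat := ShortComplex.ShortExact.extClass_naturality hT hT
      { τ₁ := φ₁, τ₂ := φ₂, τ₃ := ψ, comm₁₂ := h₁, comm₂₃ := h₂ }
    rw [← Ext.comp_assoc (a₁₂ := 1) _ _ _ (by omega) (by omega) (by omega)]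
    dsimp only at hnat
    rw [← hnat, Ext.comp_assoc_of_second_deg_zero, hact φ₁ z hφ, comp_op_smul_ext]

theorem DualCyclic.mono {M : ModuleCat.{u} A} {n : ℕ} {R : Submodule Aᵐᵒᵖ A}
    {D D' : (M ⟶ M) → A → Prop} (H : DualCyclic M n R D) (h : ∀ φ z, D' φ z → D φ z) :
    DualCyclic M n R D' :=
  ⟨H.1, H.2.imp fun _ he => ⟨he.1, he.2.1, fun φ z hz => he.2.2 φ z (h φ z hz)⟩⟩

/-! ### Sequences normalizing the left ideals of their initial segments -/

section Sequence

/-- The left ideal generated by `x 0, …, x (i - 1)`. -/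
def leftSpan (x : ℕ → A) (i : ℕ) : Submodule A A := Submodule.span A (x '' Set.Iio i)

/-- The right ideal generated by `x 0, …, x (i - 1)`. -/
def rightSpan (x : ℕ → A) (i : ℕ) : Submodule Aᵐᵒᵖ A := Submodule.span Aᵐᵒᵖ (x '' Set.Iio i)

theorem leftSpan_zero (x : ℕ → A) : leftSpan x 0 = ⊥ := by
  simp [leftSpan]

theorem rightSpan_zero (x : ℕ → A) : rightSpan x 0 = ⊥ := by
  simp [rightSpan]

theorem Iio_succ_eq_insert (i : ℕ) : Set.Iio (i + 1) = insert i (Set.Iio i) := by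
  ext j
  simp only [Set.mem_Iio, Set.mem_insert_iff]
  omega

theorem leftSpan_le_succ (x : ℕ → A) (i : ℕ) : leftSpan x i ≤ leftSpan x (i + 1) :=
  Submodule.span_mono (Set.image_mono (Set.Iio_subset_Iio (Nat.le_succ i)))

theorem rightSpan_le_succ (x : ℕ → A) (i : ℕ) : rightSpan x i ≤ rightSpan x (i + 1) :=
  Submodule.span_mono (Set.image_mono (Set.Iio_subset_Iio (Nat.le_succ i)))

theorem mem_leftSpan (x : ℕ → A) {i j : ℕ} (h : i < j) : x i ∈ leftSpan x j :=
  Submodule.subset_span ⟨i, h, rfl⟩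

theorem mem_rightSpan (x : ℕ → A) {i j : ℕ} (h : i < j) : x i ∈ rightSpan x j :=
  Submodule.subset_span ⟨i, h, rfl⟩

theorem exists_of_mem_leftSpan_succ {x : ℕ → A} {i : ℕ} {v : A} (hv : v ∈ leftSpan x (i + 1)) :
    ∃ u, v - u * x i ∈ leftSpan x i := by
  rw [leftSpan, Iio_succ_eq_insert, Set.image_insert_eq, Submodule.mem_span_insert] at hv
  obtain ⟨u, w, hw, rfl⟩ := hv
  exact ⟨u, by simpa [leftSpan] using hw⟩

theorem exists_of_mem_rightSpan_succ {x : ℕ → A} {i : ℕ} {v : A}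
    (hv : v ∈ rightSpan x (i + 1)) : ∃ u, v - x i * u ∈ rightSpan x i := by
  rw [rightSpan, Iio_succ_eq_insert, Set.image_insert_eq, Submodule.mem_span_insert] at hv
  obtain ⟨u, w, hw, rfl⟩ := hv
  exact ⟨unop u, by rw [← op_unop u, op_smul_eq_mul]; simpa [rightSpan] using hw⟩

variable {k : Type*} [CommRing k] [Algebra k A]

/-- The sequence `x` shifted by the partial traces of the matrix `γ`. -/
def traceShift (x : ℕ → A) (γ : ℕ → ℕ → k) (i : ℕ) : A :=
  x i - algebraMap k A (∑ l ∈ Finset.range i, γ i l)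

/-- If `x 0, …, x (n - 1)` normalize each of the left ideals `J i` generated by the first `i` of
them and form a regular sequence from the right, while the sequence shifted by traces is regular
from the left, then `Ext_A(A/J n, A)` is concentrated in degree `n`, where it is cyclic with
annihilator the right ideal generated by the shifted sequence. -/
theorem dualCyclic_leftSpan {x : ℕ → A} {γ : ℕ → ℕ → k} {n : ℕ}
    (hcomm : ∀ a < n, ∀ j < n,
      x j * x a - (x a - algebraMap k A (γ a j)) * x j ∈ leftSpan x j)
    (hleft : ∀ i < n, ∀ u, u * x i ∈ leftSpan x i → u ∈ leftSpan x i)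
    (hright : ∀ i < n, ∀ u, traceShift x γ i * u ∈ rightSpan (traceShift x γ) i →
      u ∈ rightSpan (traceShift x γ) i) {m : ℕ} (hm : m ≤ n) :
    DualCyclic (ModuleCat.of A (A ⧸ leftSpan x m)) m (rightSpan (traceShift x γ) m)
      (fun φ z => ∃ a < n, ∃ c : k,
        φ.hom (Submodule.Quotient.mk 1) = Submodule.Quotient.mk (x a + algebraMap k A c) ∧
        z = x a + algebraMap k A c - algebraMap k A (∑ l ∈ Finset.range m, γ a l)) := by
  -- The ideals are stable under right multiplication by every `x a + c`, so these elements define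
  -- endomorphisms of all the quotients.
  have hmul : ∀ i ≤ n, ∀ a < n, ∀ c : k, ∀ u ∈ leftSpan x i,
      u * (x a + algebraMap k A c) ∈ leftSpan x i := by
    intro i hi a ha c u hu
    induction hu using Submodule.span_induction with
    | mem u hu =>
      obtain ⟨j, hj, rfl⟩ := hu
      have hj : j < i := hj
      have h1 := Submodule.span_mono (Set.image_mono (Set.Iio_subset_Iio hj.le))
        (hcomm a ha j (by omega))
      have h2 := (leftSpan x i).smul_mem (x a - algebraMap k A (γ a j) + algebraMap k A c)
        (mem_leftSpan x hj)
      have h3 := (leftSpan x i).add_mem h1 h2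
      convert h3 using 1
      rw [mul_add, smul_eq_mul, add_mul _ (algebraMap k A c), ← Algebra.commutes c (x j)]
      abel
    | zero => rw [zero_mul]; exact zero_mem _
    | add u v _ _ hu hv => rw [add_mul]; exact add_mem hu hv
    | smul b u _ hu => rw [smul_mul_assoc]; exact Submodule.smul_mem _ b hu
  induction m with
  | zero =>
    have := dualCyclic_of_eq_bot (leftSpan_zero x)
    rw [← rightSpan_zero (traceShift x γ)] at this
    refine this.mono ?_
    rintro φ z ⟨a, _, c, h1, h2⟩
    rw [h1, h2, Finset.range_zero, Finset.sum_empty, map_zero, sub_zero]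
  | succ m ih =>
    have hx : ∀ u ∈ leftSpan x m, u * x m ∈ leftSpan x m := fun u hu => by
      simpa using hmul m (by omega) m hm 0 u hu
    have hw : quotMulRight (leftSpan x m) (leftSpan x m) (x m) hx ≫
        quotMulRight (leftSpan x m) (leftSpan x (m + 1)) 1
          (fun u hu => by simpa using leftSpan_le_succ x m hu) = 0 := by
      ext
      change Submodule.Quotient.mk (1 * x m * 1) = (0 : A ⧸ leftSpan x (m + 1))
      rw [one_mul, mul_one]
      exact (Submodule.Quotient.mk_eq_zero _).2 (mem_leftSpan x (Nat.lt_succ_self m))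
    have hT : (ShortComplex.mk _ _ hw).ShortExact :=
      { exact := by
          rw [ShortComplex.moduleCat_exact_iff]
          intro v hv
          obtain ⟨v, rfl⟩ := Submodule.Quotient.mk_surjective _ v
          have hv' : v * 1 ∈ leftSpan x (m + 1) := (Submodule.Quotient.mk_eq_zero _).1 hv
          rw [mul_one] at hv'
          obtain ⟨u, hu⟩ := exists_of_mem_leftSpan_succ hv'
          exact ⟨Submodule.Quotient.mk u, ((Submodule.Quotient.eq _).2 hu).symm⟩
        mono_f := by
          rw [ModuleCat.mono_iff_injective, injective_iff_map_eq_zero]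
          intro u hu
          obtain ⟨u, rfl⟩ := Submodule.Quotient.mk_surjective _ u
          exact (Submodule.Quotient.mk_eq_zero _).2
            (hleft m hm u ((Submodule.Quotient.mk_eq_zero _).1 hu))
        epi_g := by
          rw [ModuleCat.epi_iff_surjective]
          intro v
          obtain ⟨v, rfl⟩ := Submodule.Quotient.mk_surjective _ v
          exact ⟨Submodule.Quotient.mk v, congrArg Submodule.Quotient.mk (mul_one v)⟩ }
    -- The inductive hypothesis with `a = m` and `c = 0` says that right multiplication by `x m`
    -- acts on Ext as the shifted element.
    refine DualCyclic.step hT (ih (by omega)) (x' := traceShift x γ m)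
      ⟨m, hm, 0, ?_, ?_⟩ (hright m hm) (rightSpan_le_succ _ m)
      (mem_rightSpan _ (Nat.lt_succ_self m)) (fun v hv => exists_of_mem_rightSpan_succ hv) ?_
    · change Submodule.Quotient.mk (1 * x m) = _
      rw [one_mul, map_zero, add_zero]
    · rw [map_zero, add_zero, traceShift]
    · rintro ψ z ⟨a, ha, c, hψ, rfl⟩
      -- Modulo `leftSpan x m`, `x m * (x a + c)` equals `(x a + c - γ a m) * x m`. The lift to the
      -- subobject thus has its constant lowered by `γ a m`, which is the next summand of the
      -- partial trace; this is why `c` is kept arbitrary.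
      refine ⟨quotMulRight _ _ _ (hmul m (by omega) a ha (c - γ a m)),
        quotMulRight _ _ _ (hmul m (by omega) a ha c), ⟨a, ha, c - γ a m, ?_, ?_⟩, ?_, ?_⟩
      · change Submodule.Quotient.mk (1 * (x a + algebraMap k A (c - γ a m))) = _
        rw [one_mul]
      · rw [Finset.sum_range_succ, map_add, map_sub]
        abel
      · ext
        change Submodule.Quotient.mk (1 * (x a + algebraMap k A (c - γ a m)) * x m) =
          (Submodule.Quotient.mk (1 * x m * (x a + algebraMap k A c)) : A ⧸ leftSpan x m)
        rw [eq_comm, Submodule.Quotient.eq]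
        convert hcomm a ha m hm using 1
        rw [one_mul, one_mul, mul_add, add_mul, map_sub, sub_mul, sub_mul, Algebra.commutes c]
        abel
      · ext
        change Submodule.Quotient.mk (1 * (x a + algebraMap k A c) * 1) =
          ψ.hom (Submodule.Quotient.mk (1 * 1))
        rw [one_mul, one_mul, mul_one, hψ]

end Sequence

end KoszulExt

end VermaDuality

end

noncomputable section

namespace VermaDuality

/-! ### `RHom_A(M, A)` when `Ext_A(M, A)` is concentrated in one degree -/

section RHomConcentrated

universe u

open Abelian MulOpposite CochainComplex.HomComplex

/-- The resolution vanishes in cohomological degree `1`, so there are no nonzero coboundaries in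
degree zero. -/
theorem extMk_degree_zero_eq_zero {C : Type*} [Category C] [Abelian C] [HasExt C] {X Y : C}
    (P : ProjectiveResolution X) (f : P.complex.X 0 ⟶ Y) (hf : P.complex.d 1 0 ≫ f = 0)
    (h : P.extMk f 1 rfl hf = 0) : f = 0 := by
  simp only [← P.extEquivCohomologyClass.apply_eq_iff_eq,
    ProjectiveResolution.extEquivCohomologyClass_extMk,
    ProjectiveResolution.extEquivCohomologyClass_zero, CohomologyClass.mk_eq_zero_iff] at h
  rw [Cocycle.toSingleMk_mem_coboundaries_iff _ _ _ _ _ 1 (by simp)] at h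
  obtain ⟨g, hg⟩ := h
  have hz : g = 0 := (CochainComplex.isZero_of_isStrictlyLE P.cochainComplex 0 1).eq_of_src _ _
  rw [hz, Limits.comp_zero] at hg
  rw [← cancel_epi (P.cochainComplexXIso (-(0 : ℕ)) 0 rfl).hom, ← hg, Limits.comp_zero]

variable {A : Type u} [Ring A] {M : ModuleCat.{u} A} (P : ProjectiveResolution M) (n : ℕ)

/-- The class in `Ext^n_A(M, A)` of a cocycle `φ` in `Hom_A(P, A)`. -/
def cocycleClass (φ : P.complex.X n →ₗ[A] A) (h : φ ∘ₗ (P.complex.d (n + 1) n).hom = 0) :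
    Ext M (ModuleCat.of A A) n :=
  P.extMk (ModuleCat.ofHom φ) (n + 1) rfl (ModuleCat.hom_ext h)

theorem cocycleClass_add (φ ψ : P.complex.X n →ₗ[A] A)
    (hφ : φ ∘ₗ (P.complex.d (n + 1) n).hom = 0) (hψ : ψ ∘ₗ (P.complex.d (n + 1) n).hom = 0)
    (h : (φ + ψ) ∘ₗ (P.complex.d (n + 1) n).hom = 0) :
    cocycleClass P n (φ + ψ) h = cocycleClass P n φ hφ + cocycleClass P n ψ hψ :=
  (P.add_extMk _ _ _ _ _ _).symm

theorem cocycleClass_smul (a : Aᵐᵒᵖ) (φ : P.complex.X n →ₗ[A] A)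
    (hφ : φ ∘ₗ (P.complex.d (n + 1) n).hom = 0)
    (h : (a • φ) ∘ₗ (P.complex.d (n + 1) n).hom = 0) :
    cocycleClass P n (a • φ) h = a • cocycleClass P n φ hφ := by
  induction a using MulOpposite.rec' with | _ a =>
  rw [op_smul_ext, cocycleClass, cocycleClass, P.extMk_comp_mk₀]
  rfl

theorem cocycleClass_surjective (ξ : Ext M (ModuleCat.of A A) n) :
    ∃ φ h, cocycleClass P n φ h = ξ := by
  obtain ⟨f, hf, rfl⟩ := P.extMk_surjective ξ (n + 1) rfl
  exact ⟨f.hom, congrArg ModuleCat.Hom.hom hf, rfl⟩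

/-- Taking `m` to be the predecessor given by the complex shape treats `n = 0` uniformly: there the
predecessor is `0` itself and the differential is zero, so the right side says `φ = 0`. -/
theorem cocycleClass_eq_zero_iff (φ : P.complex.X n →ₗ[A] A)
    (h : φ ∘ₗ (P.complex.d (n + 1) n).hom = 0) (m : ℕ) (hm : (ComplexShape.up ℕ).prev n = m) :
    cocycleClass P n φ h = 0 ↔ ∃ ψ : P.complex.X m →ₗ[A] A,
      ψ ∘ₗ (P.complex.d n m).hom = φ := by
  rcases n with _ | n
  · constructor
    · intro h0
      have := congrArg ModuleCat.Hom.hom (extMk_degree_zero_eq_zero P _ _ h0)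
      exact ⟨0, by rw [LinearMap.zero_comp]; exact this.symm⟩
    · rintro ⟨ψ, rfl⟩
      have hd : P.complex.d 0 m = 0 := P.complex.shape _ _ (by simp)
      have h0 : ψ ∘ₗ (P.complex.d 0 m).hom = 0 := by rw [hd]; exact LinearMap.comp_zero ψ
      simp only [h0]
      exact P.extMk_zero 1 rfl
  · obtain rfl : n = m := by rw [← hm]; simp
    rw [cocycleClass, P.extMk_eq_zero_iff _ _ _ _ n rfl]
    exact ⟨fun ⟨g, hg⟩ => ⟨g.hom, congrArg ModuleCat.Hom.hom hg⟩,
      fun ⟨g, hg⟩ => ⟨ModuleCat.ofHom g, ModuleCat.hom_ext hg⟩⟩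

/-- A description of the homology of a short complex of modules by classes of cycles. -/
theorem nonempty_homology_iso {R : Type u} [Ring R] (S : ShortComplex (ModuleCat.{u} R))
    (N : ModuleCat.{u} R) (f : LinearMap.ker S.g.hom →ₗ[R] N) (hf : Function.Surjective f)
    (h0 : ∀ z, f z = 0 ↔ ∃ y, S.f.hom y = z.1) : Nonempty (S.homology ≅ N) := by
  have hker : LinearMap.range S.moduleCatToCycles = LinearMap.ker f := by
    ext z
    rw [LinearMap.mem_ker, h0, LinearMap.mem_range]
    exact exists_congr fun y => Subtype.ext_iff
  exact ⟨S.moduleCatHomologyIso ≪≫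
    ((Submodule.quotEquivOfEq _ _ hker).trans (f.quotKerEquivOfSurjective hf)).toModuleIso⟩

theorem mem_ker_dualComplex_iff (φ : P.complex.X n →ₗ[A] A) :
    φ ∈ LinearMap.ker ((dualComplex P.complex).sc n).g.hom ↔
      φ ∘ₗ (P.complex.d (n + 1) n).hom = 0 := by
  rw [show n + 1 = (ComplexShape.up ℕ).next n by simp]
  rfl

/-- The class in `Ext^n_A(M, A)` of a cocycle in `Hom_A(P, A)`, as a linear map. -/
def cocycleClassₗ : LinearMap.ker ((dualComplex P.complex).sc n).g.hom →ₗ[Aᵐᵒᵖ]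
      extRight M n :=
  have key (φ : LinearMap.ker ((dualComplex P.complex).sc n).g.hom) :
      (show P.complex.X n →ₗ[A] A from φ.1) ∘ₗ (P.complex.d (n + 1) n).hom = 0 :=
    (mem_ker_dualComplex_iff P n _).1 φ.2
  { toFun φ := cocycleClass P n (show P.complex.X n →ₗ[A] A from φ.1) (key φ)
    map_add' φ ψ := cocycleClass_add P n (show P.complex.X n →ₗ[A] A from φ.1)
      (show P.complex.X n →ₗ[A] A from ψ.1) (key φ) (key ψ) (key (φ + ψ))
    map_smul' a φ := cocycleClass_smul P n a (show P.complex.X n →ₗ[A] A from φ.1)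
      (key φ) (key (a • φ)) }

/-- The cohomology of `Hom_A(P, A)` is `Ext_A(M, A)`, as a right `A`-module. -/
theorem nonempty_dualComplex_homology_iso :
    Nonempty ((dualComplex P.complex).homology n ≅ extRight M n) := by
  refine nonempty_homology_iso _ _ (cocycleClassₗ P n) ?_ ?_
  · intro ξ
    obtain ⟨φ, h, rfl⟩ := cocycleClass_surjective P n ξ
    exact ⟨⟨φ, (mem_ker_dualComplex_iff P n φ).2 h⟩, rfl⟩
  · intro φ
    exact cocycleClass_eq_zero_iff P n (show P.complex.X n →ₗ[A] A from φ.1)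
      ((mem_ker_dualComplex_iff P n _).1 φ.2) _ rfl

variable [HasDerivedCategory (ModuleCat.{u} Aᵐᵒᵖ)]

/-- Vanishing of the other cohomology bounds the object in degree `n` from both sides, so it is a
single module placed in degree `n`; taking `n`-th homology identifies that module with Ext. -/
theorem nonempty_rHom_iso_singleFunctor
    (h : ∀ i, i ≠ n → Subsingleton (Ext M (ModuleCat.of A A) i)) :
    Nonempty (RHom P ≅ (DerivedCategory.singleFunctor _ (n : ℤ)).obj (extRight M n)) := by
  let K := (dualComplex P.complex).extend ComplexShape.embeddingUpNat
  have hz : ∀ i : ℤ, i ≠ n → K.ExactAt i := by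
    intro i hi
    by_cases hi' : 0 ≤ i
    · lift i to ℕ using hi'
      have hi : i ≠ n := by exact_mod_cast hi
      refine ((dualComplex P.complex).extend_exactAt_iff ComplexShape.embeddingUpNat
        (j := i) rfl).2 ?_
      rw [HomologicalComplex.exactAt_iff_isZero_homology]
      obtain ⟨e⟩ := nonempty_dualComplex_homology_iso P i
      have := h i hi
      exact (ModuleCat.isZero_of_subsingleton (extRight M i)).of_iso e
    · refine HomologicalComplex.extend_exactAt _ _ _ fun j hj => hi' ?_
      rw [← hj]
      exact Int.natCast_nonneg j
  have hGE : (RHom P).IsGE n := (DerivedCategory.isGE_Q_obj_iff K n).2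
    ((CochainComplex.isGE_iff K n).2 fun i hi => hz i hi.ne)
  have hLE : (RHom P).IsLE n := (DerivedCategory.isLE_Q_obj_iff K n).2
    ((CochainComplex.isLE_iff K n).2 fun i hi => hz i hi.ne')
  obtain ⟨Y, ⟨e⟩⟩ := (RHom P).exists_iso_singleFunctor_obj_of_isGE_of_isLE n
  obtain ⟨e₁⟩ := nonempty_dualComplex_homology_iso P n
  have e₂ : K.homology n ≅ (dualComplex P.complex).homology n :=
    (dualComplex P.complex).extendHomologyIso ComplexShape.embeddingUpNat rfl
  have e₃ : (DerivedCategory.homologyFunctor _ (n : ℤ)).obj (RHom P) ≅ K.homology n :=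
    (DerivedCategory.homologyFunctorFactors _ (n : ℤ)).app K
  have e₄ : (DerivedCategory.homologyFunctor _ (n : ℤ)).obj
      ((DerivedCategory.singleFunctor _ (n : ℤ)).obj Y) ≅ Y :=
    (DerivedCategory.homologyFunctor _ (n : ℤ)).mapIso
      ((DerivedCategory.singleFunctorIsoCompQ _ (n : ℤ)).app Y) ≪≫
    (DerivedCategory.homologyFunctorFactors _ (n : ℤ)).app _ ≪≫
    (HomologicalComplex.homologyFunctorSingleIso _ _ (n : ℤ)).app Y
  exact ⟨e ≪≫ (DerivedCategory.singleFunctor _ (n : ℤ)).mapIso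
    (e₄.symm ≪≫ (DerivedCategory.homologyFunctor _ (n : ℤ)).mapIso e.symm ≪≫ e₃ ≪≫ e₂ ≪≫ e₁)⟩

end RHomConcentrated

end VermaDuality

end

noncomputable section

namespace VermaDuality

attribute [local instance 100] LieRing.ofAssociativeRing

/-! ### Modules induced from characters are cyclic -/

section InducedCyclic

variable {k A B : Type*} [CommRing k] [Ring A] [Algebra k A] [Ring B] [Algebra k B]

/-- The left ideal generated by the elements `φ(a) - χ(a)`. -/
def charIdeal (φ : A →ₐ[k] B) (χ : A →ₐ[k] k) : Submodule B B :=
  Submodule.span B (Set.range fun a => φ a - algebraMap k B (χ a))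

/-- The identification of `B ⊗ k_χ` with `B`. -/
def tensorCharEquiv (χ : A →ₐ[k] k) : B ⊗[k] CharModule χ ≃ₗ[B] B :=
  TensorProduct.AlgebraTensorModule.rid k B B

theorem tensorCharEquiv_tmul (χ : A →ₐ[k] k) (b : B) (c : CharModule χ) :
    tensorCharEquiv χ (b ⊗ₜ[k] c) = (show k from c) • b := rfl

/-- Under the identification, a balancing relation becomes a left multiple of `φ a - χ a`, and `b =
1`, `w = 1` recovers each generator. -/
theorem map_balancing_tensorCharEquiv (φ : A →ₐ[k] B) (χ : A →ₐ[k] k) :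
    (balancing φ (CharModule χ)).map (tensorCharEquiv (B := B) χ).toLinearMap =
      charIdeal φ χ := by
  rw [balancing, Submodule.map_span, charIdeal]
  apply le_antisymm
  · rw [Submodule.span_le]
    rintro _ ⟨_, ⟨b, a, w, rfl⟩, rfl⟩
    have : tensorCharEquiv χ ((b * φ a) ⊗ₜ[k] w - b ⊗ₜ[k] (a • w)) =
        ((show k from w) • b) * (φ a - algebraMap k B (χ a)) := by
      rw [map_sub, tensorCharEquiv_tmul, tensorCharEquiv_tmul, mul_sub, smul_mul_assoc,
        ← Algebra.commutes, ← Algebra.smul_def, smul_smul]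
      rfl
    change tensorCharEquiv χ _ ∈ _
    rw [this]
    exact Submodule.smul_mem _ _ (Submodule.subset_span ⟨a, rfl⟩)
  · rw [Submodule.span_le]
    rintro _ ⟨a, rfl⟩
    refine Submodule.subset_span ⟨_, ⟨1, a, (show CharModule χ from (1 : k)), rfl⟩, ?_⟩
    change tensorCharEquiv χ _ = _
    rw [map_sub, tensorCharEquiv_tmul, tensorCharEquiv_tmul, one_mul]
    change (1 : k) • φ a - (χ a * 1) • (1 : B) = _
    simp only [one_smul, mul_one, Algebra.algebraMap_eq_smul_one]

/-- The induced module `B ⊗_A k_χ` is the quotient of `B` by the left ideal generated by the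
elements `φ(a) - χ(a)`. -/
def inducedCharEquiv (φ : A →ₐ[k] B) (χ : A →ₐ[k] k) :
    Induced φ (CharModule χ) ≃ₗ[B] B ⧸ charIdeal φ χ :=
  Submodule.Quotient.equiv _ _ (tensorCharEquiv χ) (map_balancing_tensorCharEquiv φ χ)

/-- A cyclic `B`-module whose generator has annihilator generated by the `φ(a) - χ(a)` is
induced from `χ`. -/
theorem nonempty_inducedChar_equiv (φ : A →ₐ[k] B) (χ : A →ₐ[k] k) {X : Type*} [AddCommGroup X]
    [Module B X] (e : X) (he : ∀ ξ, ∃ b : B, b • e = ξ)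
    (hann : ∀ b : B, b • e = 0 ↔ b ∈ charIdeal φ χ) :
    Nonempty (X ≃ₗ[B] Induced φ (CharModule χ)) := by
  have hker : LinearMap.ker (LinearMap.toSpanSingleton B X e) = charIdeal φ χ := by
    ext b
    exact hann b
  exact ⟨(((Submodule.quotEquivOfEq _ _ hker.symm).trans
    ((LinearMap.toSpanSingleton B X e).quotKerEquivOfSurjective he)).symm).trans
      (inducedCharEquiv φ χ).symm⟩

end InducedCyclic

/-! ### Generators of the left ideal attached to a character -/

section Generators

variable {R L : Type*} [CommRing R] [LieRing L] [LieAlgebra R L]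

/-- The universal property gives a map to `S` whose composite with the inclusion is the identity. -/
theorem eq_top_of_ι_mem (S : Subalgebra R (UniversalEnvelopingAlgebra R L))
    (h : ∀ x, UniversalEnvelopingAlgebra.ι R x ∈ S) (u : UniversalEnvelopingAlgebra R L) :
    u ∈ S := by
  let f : L →ₗ⁅R⁆ S :=
    { toFun x := ⟨UniversalEnvelopingAlgebra.ι R x, h x⟩
      map_add' x y := Subtype.ext (map_add _ x y)
      map_smul' c x := Subtype.ext (map_smul _ c x)
      map_lie' {x y} := Subtype.ext (LieHom.map_lie _ x y) }
  have hid : S.val.comp (UniversalEnvelopingAlgebra.lift R f) = AlgHom.id R _ := by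
    apply UniversalEnvelopingAlgebra.hom_ext
    ext x
    simp [f]
  have := congrArg (fun g => g u) hid
  simp only [AlgHom.comp_apply, AlgHom.id_apply] at this
  rw [← this]
  exact Subtype.property _

/-- The left ideal of the `φ(a) - χ(a)` is generated by those for `a` in a spanning family of the
Lie algebra. -/
theorem charIdeal_eq_span {B : Type*} [Ring B] [Algebra R B]
    (φ : UniversalEnvelopingAlgebra R L →ₐ[R] B) (χ : UniversalEnvelopingAlgebra R L →ₐ[R] R)
    {J : Type*} {y : J → L} (hy : Submodule.span R (Set.range y) = ⊤) :
    charIdeal φ χ = Submodule.span B (Set.range fun j =>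
      φ (UniversalEnvelopingAlgebra.ι R (y j)) -
        algebraMap R B (χ (UniversalEnvelopingAlgebra.ι R (y j)))) := by
  set I := Submodule.span B (Set.range fun j =>
      φ (UniversalEnvelopingAlgebra.ι R (y j)) -
        algebraMap R B (χ (UniversalEnvelopingAlgebra.ι R (y j)))) with hI
  apply le_antisymm
  · rw [charIdeal, Submodule.span_le]
    rintro _ ⟨u, rfl⟩
    let S : Subalgebra R (UniversalEnvelopingAlgebra R L) :=
      { carrier := {u | φ u - algebraMap R B (χ u) ∈ I}
        mul_mem' {a b} ha hb := by
          -- Uses `φ(ab) - χ(ab) = φ(a)(φ(b) - χ(b)) + χ(b)(φ(a) - χ(a))`.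
          have := I.add_mem (I.smul_mem (φ a) hb) (I.smul_mem (algebraMap R B (χ b)) ha)
          change φ (a * b) - algebraMap R B (χ (a * b)) ∈ I
          convert this using 1
          rw [map_mul φ, map_mul χ, mul_comm (χ a), map_mul (algebraMap R B), smul_eq_mul,
            smul_eq_mul, mul_sub, mul_sub, Algebra.commutes (χ b) (φ a)]
          abel
        add_mem' {a b} ha hb := by
          have := I.add_mem ha hb
          change φ (a + b) - algebraMap R B (χ (a + b)) ∈ I
          convert this using 1
          rw [map_add, map_add, map_add]
          abel
        algebraMap_mem' r := by
          change φ (algebraMap R _ r) - algebraMap R B (χ (algebraMap R _ r)) ∈ I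
          simp }
    refine eq_top_of_ι_mem S (fun x => ?_) u
    have hx : x ∈ Submodule.span R (Set.range y) := hy ▸ Submodule.mem_top
    change φ (UniversalEnvelopingAlgebra.ι R x) -
      algebraMap R B (χ (UniversalEnvelopingAlgebra.ι R x)) ∈ I
    induction hx using Submodule.span_induction with
    | mem x hx => obtain ⟨j, rfl⟩ := hx; exact Submodule.subset_span ⟨j, rfl⟩
    | zero => simp
    | add x z _ _ hx hz =>
      convert I.add_mem hx hz using 1
      simp only [map_add]
      abel
    | smul c x _ hx =>
      convert I.smul_mem (algebraMap R B c) hx using 1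
      simp only [map_smul, smul_eq_mul, map_mul, mul_sub, Algebra.smul_def]
      simp
  · rw [hI, Submodule.span_le]
    rintro _ ⟨j, rfl⟩
    exact Submodule.subset_span ⟨_, rfl⟩

end Generators

end VermaDuality

end

noncomputable section

namespace VermaDuality

attribute [local instance 100] LieRing.ofAssociativeRing

/-! ### The Poincaré–Birkhoff–Witt theorem in characteristic zero -/

section PBW

open UniversalEnvelopingAlgebra

variable {k L : Type*} [Field k] [LieRing L] [LieAlgebra k L]

variable (k L) in
/-- The comultiplication `x ↦ x ⊗ 1 + 1 ⊗ x` of `U(L)`. -/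
def comulU : UniversalEnvelopingAlgebra k L →ₐ[k]
    UniversalEnvelopingAlgebra k L ⊗[k] UniversalEnvelopingAlgebra k L :=
  lift k
    { toFun x := ι k x ⊗ₜ 1 + 1 ⊗ₜ ι k x
      map_add' x y := by
        simp only [map_add, TensorProduct.add_tmul, TensorProduct.tmul_add]
        abel
      map_smul' c x := by
        simp only [map_smul, TensorProduct.smul_tmul', TensorProduct.tmul_smul, smul_add,
          RingHom.id_apply]
      map_lie' {x y} := by
        simp only [LieHom.map_lie, LieRing.of_associative_ring_bracket, add_mul, mul_add,
          Algebra.TensorProduct.tmul_mul_tmul, one_mul, mul_one, TensorProduct.sub_tmul,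
          TensorProduct.tmul_sub]
        abel }

theorem comulU_ι (x : L) : comulU k L (ι k x) = ι k x ⊗ₜ 1 + 1 ⊗ₜ ι k x := by
  rw [comulU, lift_ι_apply]
  rfl

variable (k L) in
/-- The counit of `U(L)`, which is zero on `L`. -/
def counitU : UniversalEnvelopingAlgebra k L →ₐ[k] k := lift k 0

theorem counitU_ι (x : L) : counitU k L (ι k x) = 0 := by
  rw [counitU, lift_ι_apply]
  rfl

variable (k L) in
/-- The subspace `k + L` of `U(L)`. -/
def affineU : Submodule k (UniversalEnvelopingAlgebra k L) :=
  1 ⊔ LinearMap.range (ι k : L →ₗ⁅k⁆ UniversalEnvelopingAlgebra k L).toLinearMap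

theorem one_mem_affineU : (1 : UniversalEnvelopingAlgebra k L) ∈ affineU k L :=
  Submodule.mem_sup_left (Submodule.one_le.1 le_rfl)

theorem ι_mem_affineU (x : L) : ι k x ∈ affineU k L :=
  Submodule.mem_sup_right ⟨x, rfl⟩

theorem algebraMap_mem_affineU (c : k) : algebraMap k _ c ∈ affineU k L :=
  Submodule.mem_sup_left (Submodule.algebraMap_mem c)

theorem mem_affineU_iff {u : UniversalEnvelopingAlgebra k L} :
    u ∈ affineU k L ↔ ∃ (c : k) (x : L), u = algebraMap k _ c + ι k x := by
  rw [affineU, Submodule.mem_sup]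
  constructor
  · rintro ⟨_, hc, _, ⟨x, rfl⟩, rfl⟩
    obtain ⟨c, rfl⟩ := Submodule.mem_one.1 hc
    exact ⟨c, x, rfl⟩
  · rintro ⟨c, x, rfl⟩
    exact ⟨_, Submodule.algebraMap_mem c, _, ⟨x, rfl⟩, rfl⟩

theorem affineU_pow_mono {m n : ℕ} (h : m ≤ n) : affineU k L ^ m ≤ affineU k L ^ n := by
  induction h with
  | refl => exact le_rfl
  | step h ih =>
    refine ih.trans fun u hu => ?_
    rw [Nat.succ_eq_add_one, pow_succ, ← mul_one u]
    exact Submodule.mul_mem_mul hu one_mem_affineU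

theorem exists_mem_affineU_pow (u : UniversalEnvelopingAlgebra k L) :
    ∃ n, u ∈ affineU k L ^ n := by
  let S : Subalgebra k (UniversalEnvelopingAlgebra k L) :=
    { carrier := {u | ∃ n, u ∈ affineU k L ^ n}
      mul_mem' := by
        rintro a b ⟨m, ha⟩ ⟨n, hb⟩
        exact ⟨m + n, by rw [pow_add]; exact Submodule.mul_mem_mul ha hb⟩
      add_mem' := by
        rintro a b ⟨m, ha⟩ ⟨n, hb⟩
        exact ⟨max m n, add_mem (affineU_pow_mono (le_max_left m n) ha)
          (affineU_pow_mono (le_max_right m n) hb)⟩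
      algebraMap_mem' c := ⟨1, by rw [pow_one]; exact algebraMap_mem_affineU c⟩ }
  exact eq_top_of_ι_mem S (fun x => ⟨1, by rw [pow_one]; exact ι_mem_affineU x⟩) u

theorem algebraMap_tmul_one (c : k) :
    algebraMap k (UniversalEnvelopingAlgebra k L) c ⊗ₜ[k] (1 : UniversalEnvelopingAlgebra k L) =
      1 ⊗ₜ algebraMap k _ c := by
  rw [Algebra.algebraMap_eq_smul_one, ← TensorProduct.smul_tmul]

theorem comulU_of_mem_affineU {w : UniversalEnvelopingAlgebra k L} (hw : w ∈ affineU k L) :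
    comulU k L w = (w - algebraMap k _ (counitU k L w)) ⊗ₜ 1 + 1 ⊗ₜ w := by
  obtain ⟨c, x, rfl⟩ := mem_affineU_iff.1 hw
  rw [map_add, map_add, counitU_ι, comulU_ι, AlgHom.commutes, AlgHom.commutes,
    Algebra.algebraMap_self_apply, add_zero, add_sub_cancel_left, TensorProduct.tmul_add,
    Algebra.TensorProduct.algebraMap_apply, algebraMap_tmul_one]
  abel

variable {S : Type*} [CommRing S] [Algebra k S]

/-- The convolution product of linear maps from `U(L)` to a commutative algebra. -/
def convU (f g : UniversalEnvelopingAlgebra k L →ₗ[k] S) :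
    UniversalEnvelopingAlgebra k L →ₗ[k] S :=
  LinearMap.mul' k S ∘ₗ TensorProduct.map f g ∘ₗ (comulU k L).toLinearMap

theorem convU_algebraMap (f g : UniversalEnvelopingAlgebra k L →ₗ[k] S) (c : k) :
    convU f g (algebraMap k _ c) = f 1 * g (algebraMap k _ c) := by
  have : comulU k L (algebraMap k _ c) = 1 ⊗ₜ algebraMap k _ c := by
    rw [AlgHom.commutes, Algebra.TensorProduct.algebraMap_apply, algebraMap_tmul_one]
  change LinearMap.mul' k S (TensorProduct.map f g (comulU k L (algebraMap k _ c))) = _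
  rw [this, TensorProduct.map_tmul, LinearMap.mul'_apply]

theorem convU_mul (f g : UniversalEnvelopingAlgebra k L →ₗ[k] S)
    {w : UniversalEnvelopingAlgebra k L} (hw : w ∈ affineU k L)
    (u : UniversalEnvelopingAlgebra k L) :
    convU f g (w * u) =
      convU (f ∘ₗ LinearMap.mulLeft k (w - algebraMap k _ (counitU k L w))) g u +
        convU f (g ∘ₗ LinearMap.mulLeft k w) u := by
  change LinearMap.mul' k S (TensorProduct.map f g (comulU k L (w * u))) =
    LinearMap.mul' k S (TensorProduct.map _ g (comulU k L u)) +
      LinearMap.mul' k S (TensorProduct.map f _ (comulU k L u))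
  rw [map_mul, comulU_of_mem_affineU hw]
  induction comulU k L u with
  | zero => simp
  | add a b ha hb =>
    rw [mul_add, map_add, map_add, ha, hb]
    simp only [map_add]
    abel
  | tmul a b =>
    simp only [add_mul, Algebra.TensorProduct.tmul_mul_tmul, one_mul, map_add,
      TensorProduct.map_tmul, LinearMap.mul'_apply, LinearMap.comp_apply,
      LinearMap.mulLeft_apply]

/-- The comultiplication of an element of filtration degree `n` is `1 ⊗ u` plus terms whose second
factor has lower degree, and `g` kills those. -/
theorem convU_of_vanishing {n : ℕ} : ∀ (f g : UniversalEnvelopingAlgebra k L →ₗ[k] S),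
    (∀ d < n, ∀ v ∈ affineU k L ^ d, g v = 0) → ∀ u ∈ affineU k L ^ n,
      convU f g u = f 1 * g u := by
  induction n with
  | zero =>
    intro f g _ u hu
    rw [pow_zero] at hu
    obtain ⟨c, rfl⟩ := Submodule.mem_one.1 hu
    exact convU_algebraMap f g c
  | succ n ih =>
    intro f g hg u hu
    rw [pow_succ'] at hu
    induction hu using Submodule.mul_induction_on' with
    | mem_mul_mem w hw u hu =>
      rw [convU_mul f g hw, ih _ g (fun d hd => hg d (by omega)) u hu,
        ih f _ (fun d hd v hv => ?_) u hu, hg n (by omega) u hu, mul_zero, zero_add]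
      · rfl
      · refine hg (d + 1) (by omega) _ ?_
        rw [pow_succ']
        exact Submodule.mul_mem_mul hw hv
    | add u _ v _ hu hv => rw [map_add, map_add, hu, hv, mul_add]

theorem convU_congr {n : ℕ} {f g g' : UniversalEnvelopingAlgebra k L →ₗ[k] S} (hf : f 1 = 0)
    (hg : ∀ d < n, ∀ v ∈ affineU k L ^ d, g v = g' v) {u : UniversalEnvelopingAlgebra k L}
    (hu : u ∈ affineU k L ^ n) : convU f g u = convU f g' u := by
  have h := convU_of_vanishing f (g - g') (fun d hd v hv => sub_eq_zero.2 (hg d hd v hv)) u hu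
  rw [hf, zero_mul] at h
  have h2 : convU f (g - g') u = convU f g u - convU f g' u := by
    change LinearMap.mul' k S (TensorProduct.map f (g - g') (comulU k L u)) =
      LinearMap.mul' k S (TensorProduct.map f g (comulU k L u)) -
        LinearMap.mul' k S (TensorProduct.map f g' (comulU k L u))
    induction comulU k L u with
    | zero => simp
    | add a b ha hb =>
      simp only [map_add, ha, hb]
      abel
    | tmul a b =>
      simp only [TensorProduct.map_tmul, LinearMap.mul'_apply, LinearMap.sub_apply, mul_sub]
  rw [← sub_eq_zero, ← h2, h]

/-- The divided convolution powers `f^{*n} / n!`. -/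
def dividedConv (f : UniversalEnvelopingAlgebra k L →ₗ[k] S) :
    ℕ → UniversalEnvelopingAlgebra k L →ₗ[k] S
  | 0 => Algebra.linearMap k S ∘ₗ (counitU k L).toLinearMap
  | n + 1 => ((n + 1 : ℕ) : k)⁻¹ • convU f (dividedConv f n)

variable {f : UniversalEnvelopingAlgebra k L →ₗ[k] S} (hf : f 1 = 0)

include hf

theorem dividedConv_eq_zero {n d : ℕ} (h : d < n) : ∀ u ∈ affineU k L ^ d,
    dividedConv f n u = 0 := by
  induction n generalizing d with
  | zero => omega
  | succ n ih =>
    intro u hu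
    rw [dividedConv, LinearMap.smul_apply,
      convU_of_vanishing f _ (fun e he v hv => ih (by omega) v hv) u hu, hf, zero_mul, smul_zero]

variable [CharZero k]

/-- A Leibniz computation: splitting off `w` in the convolution of `f` with the `(n+1)`-st divided
power gives `s = f w * dividedConv f (n + 1) u` once from the first factor, and `n + 1` times from
the second by induction. The total `(n + 2) • s` is cancelled by the new denominator. -/
theorem dividedConv_mul {n : ℕ} {w u : UniversalEnvelopingAlgebra k L} (hw : w ∈ affineU k L)
    (hu : u ∈ affineU k L ^ n) :
    dividedConv f (n + 1) (w * u) = f w * dividedConv f n u := by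
  induction n generalizing u with
  | zero =>
    rw [pow_zero] at hu
    obtain ⟨c, rfl⟩ := Submodule.mem_one.1 hu
    have h1 : convU f (dividedConv f 0) (w * algebraMap k _ c) =
        f w * dividedConv f 0 (algebraMap k _ c) := by
      rw [convU_mul f _ hw, convU_algebraMap, convU_algebraMap, hf, zero_mul, add_zero]
      congr 1
      simp [hf, Algebra.algebraMap_eq_smul_one]
    change ((0 + 1 : ℕ) : k)⁻¹ • convU f (dividedConv f 0) (w * algebraMap k _ c) = _
    rw [h1]
    simp
  | succ n ih =>
    have h1 : convU f (dividedConv f (n + 1)) (w * u) =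
        f w * dividedConv f (n + 1) u + convU f (f w • dividedConv f n) u := by
      rw [convU_mul f _ hw,
        convU_of_vanishing _ _ (fun d hd v hv => dividedConv_eq_zero hf hd v hv) u hu]
      congr 1
      · simp [hf, Algebra.algebraMap_eq_smul_one]
      · refine convU_congr hf (fun d hd v hv => ?_) hu
        exact ih (affineU_pow_mono (by omega) hv)
    have h2 : convU f (f w • dividedConv f n) u = f w * convU f (dividedConv f n) u := by
      change LinearMap.mul' k S (TensorProduct.map f (f w • dividedConv f n) (comulU k L u)) =
        f w * LinearMap.mul' k S (TensorProduct.map f (dividedConv f n) (comulU k L u))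
      induction comulU k L u with
      | zero => simp
      | add a b ha hb => simp only [map_add, ha, hb, mul_add]
      | tmul a b =>
        simp only [TensorProduct.map_tmul, LinearMap.mul'_apply, LinearMap.smul_apply,
          smul_eq_mul]
        ring
    have h3 : convU f (dividedConv f n) u = ((n + 1 : ℕ) : k) • dividedConv f (n + 1) u := by
      rw [dividedConv, LinearMap.smul_apply, smul_smul,
        mul_inv_cancel₀ (Nat.cast_ne_zero.2 n.succ_ne_zero), one_smul]
    rw [dividedConv, LinearMap.smul_apply, h1, h2, h3, mul_smul_comm]
    set s := f w * dividedConv f (n + 1) u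
    have h4 : s + ((n + 1 : ℕ) : k) • s = ((n + 1 + 1 : ℕ) : k) • s := by
      rw [Nat.cast_succ (n + 1), add_smul, one_smul, add_comm]
    rw [h4, smul_smul, inv_mul_cancel₀ (Nat.cast_ne_zero.2 (n + 1).succ_ne_zero), one_smul]

/-- The divided power of order `n` acts as a leading symbol: it kills lower filtration degree and is
multiplicative on products of `n` elements of `k + L`. This is how commuting monomials detect
noncommuting ones. -/
theorem dividedConv_list_prod (l : List (UniversalEnvelopingAlgebra k L))
    (hl : ∀ w ∈ l, w ∈ affineU k L) :
    l.prod ∈ affineU k L ^ l.length ∧ dividedConv f l.length l.prod = (l.map f).prod := by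
  induction l with
  | nil =>
    refine ⟨by rw [List.prod_nil, List.length_nil, pow_zero]; exact Submodule.one_le.1 le_rfl, ?_⟩
    simp [dividedConv]
  | cons w l ih =>
    obtain ⟨h1, h2⟩ := ih fun v hv => hl v (List.mem_cons_of_mem w hv)
    have hw := hl w List.mem_cons_self
    rw [List.prod_cons, List.length_cons, List.map_cons, List.prod_cons,
      dividedConv_mul hf hw h1, h2, pow_succ']
    exact ⟨Submodule.mul_mem_mul hw h1, rfl⟩

end PBW

end VermaDuality

end

noncomputable section

namespace VermaDuality

attribute [local instance 100] LieRing.ofAssociativeRing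

/-! ### Ordered monomials form a basis of the enveloping algebra -/

section OrderedMonomials

open UniversalEnvelopingAlgebra

section Lists

variable {A : Type*} (z : ℕ → A)

/-- The list in which `z l` is repeated `α l` times, for `l = 0, …, t - 1`. -/
def monList (α : ℕ →₀ ℕ) (t : ℕ) : List A :=
  (List.range t).flatMap fun l => List.replicate (α l) (z l)

theorem monList_succ (α : ℕ →₀ ℕ) (t : ℕ) :
    monList z α (t + 1) = monList z α t ++ List.replicate (α t) (z t) := by
  rw [monList, List.range_succ, List.flatMap_append, List.flatMap_singleton, monList]

theorem length_monList (α : ℕ →₀ ℕ) (t : ℕ) :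
    (monList z α t).length = ∑ l ∈ Finset.range t, α l := by
  induction t with
  | zero => rfl
  | succ t ih => rw [monList_succ, List.length_append, List.length_replicate, ih,
      Finset.sum_range_succ]

theorem mem_monList {α : ℕ →₀ ℕ} {t : ℕ} {w : A} (h : w ∈ monList z α t) :
    ∃ l < t, w = z l := by
  rw [monList, List.mem_flatMap] at h
  obtain ⟨l, hl, h⟩ := h
  exact ⟨l, List.mem_range.1 hl, (List.mem_replicate.1 h).2⟩

theorem cons_monList_perm (α : ℕ →₀ ℕ) {j t : ℕ} (hj : j < t) :
    (z j :: monList z α t).Perm (monList z (α + Finsupp.single j 1) t) := by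
  induction t with
  | zero => omega
  | succ t ih =>
    rw [monList_succ, monList_succ]
    rcases Nat.lt_succ_iff_lt_or_eq.1 hj with h | rfl
    · have h1 : (α + Finsupp.single j 1 : ℕ →₀ ℕ) t = α t := by
        simp [h.ne]
      rw [h1, ← List.cons_append]
      exact (ih h).append_right _
    · have h1 : monList z (α + Finsupp.single j 1) j = monList z α j := by
        rw [monList, monList]
        refine List.flatMap_congr fun l hl => ?_
        have := List.mem_range.1 hl
        simp [this.ne']
      rw [h1]
      simp only [Finsupp.coe_add, Pi.add_apply, Finsupp.single_eq_same, List.replicate_succ]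
      exact List.perm_middle.symm

variable [Monoid A]

/-- The ordered monomial `z 0 ^ α 0 ⋯ z (t - 1) ^ α (t - 1)`. -/
def orderedMon (α : ℕ →₀ ℕ) (t : ℕ) : A := (monList z α t).prod

theorem orderedMon_succ (α : ℕ →₀ ℕ) (t : ℕ) :
    orderedMon z α (t + 1) = orderedMon z α t * z t ^ α t := by
  rw [orderedMon, monList_succ, List.prod_append, List.prod_replicate, orderedMon]

theorem orderedMon_of_support {α : ℕ →₀ ℕ} {t m : ℕ} (htm : t ≤ m)
    (h : ∀ l, t ≤ l → α l = 0) : orderedMon z α m = orderedMon z α t := by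
  induction htm with
  | refl => rfl
  | @step m hm ih => rw [Nat.succ_eq_add_one, orderedMon_succ, h m hm, pow_zero, mul_one, ih]

theorem orderedMon_congr {α β : ℕ →₀ ℕ} {t : ℕ} (h : ∀ l < t, α l = β l) :
    orderedMon z α t = orderedMon z β t := by
  induction t with
  | zero => rfl
  | succ t ih =>
    rw [orderedMon_succ, orderedMon_succ, h t (Nat.lt_succ_self t),
      ih fun l hl => h l (by omega)]

theorem orderedMon_mul {α : ℕ →₀ ℕ} {t m : ℕ} (htm : t < m) (h : ∀ l, t < l → α l = 0) :
    orderedMon z α m * z t = orderedMon z (α + Finsupp.single t 1) m := by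
  have h' : ∀ l, t < l → (α + Finsupp.single t 1 : ℕ →₀ ℕ) l = 0 := fun l hl => by
    simp [h l hl, hl.ne]
  rw [orderedMon_of_support z htm fun l hl => h l hl,
    orderedMon_of_support z htm fun l hl => h' l hl, orderedMon_succ, orderedMon_succ,
    mul_assoc, ← pow_succ]
  congr 1
  · refine orderedMon_congr z fun l hl => ?_
    simp [hl.ne']
  · simp

end Lists

variable {k L : Type*} [Field k] [LieRing L] [LieAlgebra k L]

theorem commutator_mem_affineU {v w : UniversalEnvelopingAlgebra k L} (hv : v ∈ affineU k L)
    (hw : w ∈ affineU k L) : v * w - w * v ∈ affineU k L := by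
  obtain ⟨c, x, rfl⟩ := mem_affineU_iff.1 hv
  obtain ⟨d, y, rfl⟩ := mem_affineU_iff.1 hw
  have h1 := Algebra.commutes c (ι k y)
  have h2 := Algebra.commutes d (ι k x)
  have h3 := Algebra.commutes c (algebraMap k (UniversalEnvelopingAlgebra k L) d)
  convert ι_mem_affineU ⁅x, y⁆ using 1
  rw [LieHom.map_lie, LieRing.of_associative_ring_bracket, add_mul, mul_add, mul_add, add_mul,
    mul_add, mul_add, h1, h2, h3]
  abel

/-- Swapping two neighbours replaces their product by a commutator, which lies in `k + L` and so
saves one filtration degree. -/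
theorem prod_sub_prod_mem_of_perm {l l' : List (UniversalEnvelopingAlgebra k L)} (h : l.Perm l')
    (hl : ∀ w ∈ l, w ∈ affineU k L) :
    l.prod - l'.prod ∈ affineU k L ^ (l.length - 1) := by
  have hprod : ∀ l : List (UniversalEnvelopingAlgebra k L), (∀ w ∈ l, w ∈ affineU k L) →
      l.prod ∈ affineU k L ^ l.length := by
    intro l hl
    induction l with
    | nil => rw [List.prod_nil, List.length_nil, pow_zero]; exact Submodule.one_le.1 le_rfl
    | cons w l ih =>
      rw [List.prod_cons, List.length_cons, pow_succ']
      exact Submodule.mul_mem_mul (hl w List.mem_cons_self)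
        (ih fun v hv => hl v (List.mem_cons_of_mem w hv))
  induction h with
  | nil => rw [sub_self]; exact zero_mem _
  | @cons w l l' h ih =>
    rw [List.prod_cons, List.prod_cons, ← mul_sub]
    rcases Nat.eq_zero_or_pos l.length with h0 | hpos
    · rw [List.length_eq_zero_iff] at h0
      subst h0
      rw [List.nil_perm.1 h, sub_self, mul_zero]
      exact zero_mem _
    · have := Submodule.mul_mem_mul (hl w List.mem_cons_self)
        (ih fun v hv => hl v (List.mem_cons_of_mem w hv))
      rw [← pow_succ'] at this
      rwa [List.length_cons, show l.length + 1 - 1 = l.length - 1 + 1 by omega]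
  | swap x y l =>
    have hy := hl y List.mem_cons_self
    have hx := hl x (by simp)
    rw [List.prod_cons, List.prod_cons, List.prod_cons, List.prod_cons, ← mul_assoc, ← mul_assoc,
      ← sub_mul]
    have := Submodule.mul_mem_mul (commutator_mem_affineU hy hx)
      (hprod l fun v hv => hl v (by simp [hv]))
    rwa [← pow_succ'] at this
  | trans h₁ h₂ ih₁ ih₂ =>
    have h1 := ih₁ hl
    have h2 := ih₂ fun w hw => hl w (h₁.mem_iff.2 hw)
    rw [← h₁.length_eq] at h2
    convert add_mem h1 h2 using 1
    abel

/-- The exponents of monomials in the first `t` variables. -/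
def exponents (t : ℕ) : Set (ℕ →₀ ℕ) := {α | ∀ l, t ≤ l → α l = 0}

theorem exponents_mono {s t : ℕ} (h : s ≤ t) : exponents s ⊆ exponents t :=
  fun _ hα l hl => hα l (h.trans hl)

variable {m : ℕ} (B : Module.Basis (Fin m) k L) {z : ℕ → UniversalEnvelopingAlgebra k L}
  {c : Fin m → k} (hz : ∀ j : Fin m, z j = ι k (B j) - algebraMap k _ (c j))

include hz

theorem mem_affineU_of_lt {l : ℕ} (hl : l < m) : z l ∈ affineU k L := by
  rw [show z l = _ from hz ⟨l, hl⟩]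
  exact sub_mem (ι_mem_affineU _) (algebraMap_mem_affineU _)

theorem affineU_le_span :
    affineU k L ≤ Submodule.span k (insert 1 (z '' Set.Iio m)) := by
  intro w hw
  obtain ⟨a, x, rfl⟩ := mem_affineU_iff.1 hw
  have h1 : ∀ a : k, algebraMap k (UniversalEnvelopingAlgebra k L) a ∈
      Submodule.span k (insert 1 (z '' Set.Iio m)) := fun a => by
    rw [Algebra.algebraMap_eq_smul_one]
    exact Submodule.smul_mem _ _ (Submodule.subset_span (Set.mem_insert _ _))
  refine add_mem (h1 a) ?_
  rw [← B.sum_repr x, map_sum]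
  refine sum_mem fun j _ => ?_
  rw [map_smul]
  refine Submodule.smul_mem _ _ ?_
  have h2 : ι k (B j) = z j + algebraMap k _ (c j) := by rw [hz j, sub_add_cancel]
  rw [h2]
  exact add_mem (Submodule.subset_span (Set.mem_insert_of_mem _ ⟨j, j.2, rfl⟩)) (h1 _)

theorem affineU_pow_le_span (n : ℕ) :
    affineU k L ^ n ≤ Submodule.span k
      ((fun α => orderedMon z α m) '' {α ∈ exponents m | ∑ l ∈ Finset.range m, α l ≤ n}) := by
  induction n with
  | zero =>
    rw [pow_zero, Submodule.one_le]
    refine Submodule.subset_span ⟨0, ⟨fun _ _ => rfl, by simp⟩, ?_⟩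
    change orderedMon z 0 m = 1
    rw [orderedMon_of_support z (Nat.zero_le m) fun _ _ => rfl]
    rfl
  | succ n ih =>
    have hmono : Submodule.span k ((fun α => orderedMon z α m) ''
          {α ∈ exponents m | ∑ l ∈ Finset.range m, α l ≤ n}) ≤
        Submodule.span k ((fun α => orderedMon z α m) ''
          {α ∈ exponents m | ∑ l ∈ Finset.range m, α l ≤ n + 1}) :=
      Submodule.span_mono (Set.image_mono fun α hα => ⟨hα.1, hα.2.trans (Nat.le_succ n)⟩)
    rw [pow_succ']
    refine (mul_le_mul' (affineU_le_span B hz) ih).trans ?_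
    rw [Submodule.span_mul_span, Submodule.span_le]
    rintro _ ⟨w, hw, _, ⟨α, ⟨hα, hαn⟩, rfl⟩, rfl⟩
    rcases hw with rfl | ⟨j, hj, rfl⟩
    · change 1 * orderedMon z α m ∈ _
      rw [one_mul]
      exact hmono (Submodule.subset_span ⟨α, ⟨hα, hαn⟩, rfl⟩)
    · have hj : j < m := hj
      -- Sorting the new factor `z j` into its place costs only an error of degree at most `n`,
      -- which the inductive hypothesis covers.
      have h1 := prod_sub_prod_mem_of_perm (cons_monList_perm z α hj) (by
        intro w hw
        rcases List.mem_cons.1 hw with rfl | hw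
        · exact mem_affineU_of_lt B hz hj
        · obtain ⟨l, hl, rfl⟩ := mem_monList z hw
          exact mem_affineU_of_lt B hz hl)
      rw [List.length_cons, Nat.add_sub_cancel, length_monList, List.prod_cons] at h1
      have h2 := hmono (ih (affineU_pow_mono hαn h1))
      have h3 : orderedMon z (α + Finsupp.single j 1) m ∈
          Submodule.span k ((fun α => orderedMon z α m) ''
            {α ∈ exponents m | ∑ l ∈ Finset.range m, α l ≤ n + 1}) := by
        refine Submodule.subset_span ⟨_, ⟨fun l hl => ?_, ?_⟩, rfl⟩
        · simp [hα l hl, (hj.trans_le hl).ne]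
        · have h4 : ∑ l ∈ Finset.range m, (Finsupp.single j 1 : ℕ →₀ ℕ) l = 1 := by
            rw [Finset.sum_eq_single_of_mem j (Finset.mem_range.2 hj) fun l _ hl =>
              Finsupp.single_eq_of_ne hl, Finsupp.single_eq_same]
          simp only [Finsupp.coe_add, Pi.add_apply, Finset.sum_add_distrib, h4]
          omega
      have h5 := add_mem h2 h3
      rwa [orderedMon, sub_add_cancel] at h5

/-- Ordered monomials span the enveloping algebra. -/
theorem span_orderedMon :
    Submodule.span k ((fun α => orderedMon z α m) '' exponents m) = ⊤ := by
  rw [eq_top_iff]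
  intro u _
  obtain ⟨n, hn⟩ := exists_mem_affineU_pow u
  exact Submodule.span_mono (Set.image_mono fun α hα => hα.1) (affineU_pow_le_span B hz n hn)

variable [CharZero k]

/-- Ordered monomials in the elements of a basis, shifted by constants, are linearly independent
in the enveloping algebra of a Lie algebra which embeds into it. -/
theorem linearIndepOn_orderedMon
    (hι : Function.Injective (ι k : L →ₗ⁅k⁆ UniversalEnvelopingAlgebra k L)) :
    LinearIndepOn k (fun α => orderedMon z α m) (exponents m) := by
  obtain ⟨q, hq⟩ := LinearMap.exists_leftInverse_of_injective
    (ι k : L →ₗ⁅k⁆ UniversalEnvelopingAlgebra k L).toLinearMap (LinearMap.ker_eq_bot.2 hι)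
  let f₀ : UniversalEnvelopingAlgebra k L →ₗ[k] MvPolynomial ℕ k :=
    B.constr k (fun j : Fin m => (MvPolynomial.X (j : ℕ) : MvPolynomial ℕ k)) ∘ₗ q
  -- Subtracting a multiple of the counit forces `f 1 = 0` without changing `f` on `L`; hence the
  -- constants `c j` do not matter.
  let f : UniversalEnvelopingAlgebra k L →ₗ[k] MvPolynomial ℕ k :=
    f₀ - (LinearMap.toSpanSingleton k _ (f₀ 1)) ∘ₗ (counitU k L).toLinearMap
  have hf : f 1 = 0 := by simp [f]
  have hfz : ∀ l < m, f (z l) = MvPolynomial.X l := by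
    intro l hl
    have h1 : f (ι k (B ⟨l, hl⟩)) = MvPolynomial.X l := by
      have : q (ι k (B ⟨l, hl⟩)) = B ⟨l, hl⟩ := LinearMap.congr_fun hq _
      change B.constr k _ (q (ι k (B ⟨l, hl⟩))) - counitU k L (ι k (B ⟨l, hl⟩)) • f₀ 1 = _
      rw [counitU_ι, zero_smul, sub_zero, this, Module.Basis.constr_basis]
    rw [show z l = _ from hz ⟨l, hl⟩, map_sub, h1, Algebra.algebraMap_eq_smul_one, map_smul, hf,
      smul_zero, sub_zero]
  have hmap : ∀ α ∈ exponents m, ((monList z α m).map f).prod = MvPolynomial.monomial α 1 := by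
    intro α hα
    have key : ∀ t ≤ m, ((monList z α t).map f).prod =
        ∏ l ∈ Finset.range t, (MvPolynomial.X l : MvPolynomial ℕ k) ^ α l := by
      intro t ht
      induction t with
      | zero => rfl
      | succ t ih =>
        rw [monList_succ, List.map_append, List.prod_append, ih (by omega), List.map_replicate,
          List.prod_replicate, hfz t (by omega), Finset.prod_range_succ]
    rw [key m le_rfl, MvPolynomial.monomial_eq, Finsupp.prod, MvPolynomial.C_1, one_mul]
    refine (Finset.prod_subset (fun l hl => ?_) fun l _ hl => ?_).symm
    · rw [Finset.mem_range]
      by_contra h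
      exact Finsupp.mem_support_iff.1 hl (hα l (by omega))
    · rw [Finsupp.notMem_support_iff.1 hl, pow_zero]
  have hmem : ∀ α, ∀ w ∈ monList z α m, w ∈ affineU k L := by
    intro α w hw
    obtain ⟨l, hl, rfl⟩ := mem_monList z hw
    exact mem_affineU_of_lt B hz hl
  rw [linearIndepOn_iff]
  intro p hp h0
  by_contra hne
  -- The divided power of top degree kills the lower terms of the relation and sends those of top
  -- degree to distinct commutative monomials.
  obtain ⟨α₀, hα₀, hmax⟩ := p.support.exists_max_image (fun α => ∑ l ∈ Finset.range m, α l)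
    (Finsupp.support_nonempty_iff.2 hne)
  have h1 := congrArg (fun u => MvPolynomial.coeff α₀
    (dividedConv f (∑ l ∈ Finset.range m, α₀ l) u)) h0
  simp only [map_zero, MvPolynomial.coeff_zero] at h1
  rw [Finsupp.linearCombination_apply, Finsupp.sum, map_sum, MvPolynomial.coeff_sum,
    Finset.sum_eq_single_of_mem α₀ hα₀] at h1
  · rw [map_smul, ← length_monList z α₀ m, orderedMon,
      (dividedConv_list_prod hf _ (hmem α₀)).2, hmap α₀ (hp hα₀), MvPolynomial.coeff_smul,
      MvPolynomial.coeff_monomial, if_pos rfl, smul_eq_mul, mul_one] at h1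
    exact Finsupp.mem_support_iff.1 hα₀ h1
  · intro α hα hne
    rw [map_smul, MvPolynomial.coeff_smul]
    have h2 := dividedConv_list_prod hf _ (hmem α)
    rw [length_monList] at h2
    rcases (hmax α hα).lt_or_eq with h | h
    · rw [orderedMon, dividedConv_eq_zero hf h _ h2.1, MvPolynomial.coeff_zero, smul_zero]
    · rw [orderedMon, ← h, h2.2, hmap α (hp hα), MvPolynomial.coeff_monomial, if_neg hne,
        smul_zero]

end OrderedMonomials

end VermaDuality

end

noncomputable section

namespace VermaDuality

/-! ### Regularity of sequences with a basis of ordered monomials -/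

section Regularity

variable {k A : Type*} [Field k] [Ring A] [Algebra k A] (z : ℕ → A) (m : ℕ)

/-- The left ideal generated by `z t, …, z (m - 1)`. -/
def tailSpan (t : ℕ) : Submodule A A := Submodule.span A (z '' Set.Ico t m)

theorem mem_tailSpan {t j : ℕ} (h : t ≤ j) (hj : j < m) : z j ∈ tailSpan z m t :=
  Submodule.subset_span ⟨j, ⟨h, hj⟩, rfl⟩

theorem tailSpan_mono {s t : ℕ} (h : s ≤ t) : tailSpan z m t ≤ tailSpan z m s :=
  Submodule.span_mono (Set.image_mono (Set.Ico_subset_Ico_left h))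

theorem tailSpan_self : tailSpan z m m = ⊥ := by
  simp [tailSpan]

theorem exists_of_mem_tailSpan {t : ℕ} (ht : t < m) {v : A} (hv : v ∈ tailSpan z m t) :
    ∃ u, v - u * z t ∈ tailSpan z m (t + 1) := by
  have h : Set.Ico t m = insert t (Set.Ico (t + 1) m) := by
    ext j
    simp only [Set.mem_Ico, Set.mem_insert_iff]
    omega
  rw [tailSpan, h, Set.image_insert_eq, Submodule.mem_span_insert] at hv
  obtain ⟨u, w, hw, rfl⟩ := hv
  exact ⟨u, by simpa [tailSpan] using hw⟩

variable (k) in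
/-- The span of the ordered monomials in the first `t` variables. -/
def headSpan (t : ℕ) : Submodule k A :=
  Submodule.span k ((fun α => orderedMon z α m) '' exponents t)

theorem headSpan_mono {s t : ℕ} (h : s ≤ t) : headSpan k z m s ≤ headSpan k z m t :=
  Submodule.span_mono (Set.image_mono (exponents_mono h))

theorem add_single_mem_exponents {t : ℕ} {α : ℕ →₀ ℕ} (h : α ∈ exponents (t + 1)) :
    α + Finsupp.single t 1 ∈ exponents (t + 1) := by
  intro l hl
  have hl' : t < l := hl
  simp [h l hl, hl'.ne]

variable {z m}

theorem headSpan_mul {t : ℕ} (ht : t < m) {q : A} (hq : q ∈ headSpan k z m (t + 1)) :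
    q * z t ∈ Submodule.span k ((fun α => orderedMon z α m) ''
      {α ∈ exponents (t + 1) | α t ≠ 0}) := by
  induction hq using Submodule.span_induction with
  | mem q hq =>
    obtain ⟨α, hα, rfl⟩ := hq
    dsimp only
    rw [orderedMon_mul z ht fun l hl => hα l hl]
    exact Submodule.subset_span ⟨_, ⟨add_single_mem_exponents hα, by simp⟩, rfl⟩
  | zero => rw [zero_mul]; exact zero_mem _
  | add u v _ _ hu hv => rw [add_mul]; exact add_mem hu hv
  | smul a u _ hu => rw [smul_mul_assoc]; exact Submodule.smul_mem _ _ hu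

theorem headSpan_mul_mem {t : ℕ} (ht : t < m) {q : A} (hq : q ∈ headSpan k z m (t + 1)) :
    q * z t ∈ headSpan k z m (t + 1) :=
  Submodule.span_mono (Set.image_mono fun _ hα => hα.1) (headSpan_mul ht hq)

/-- An ordered monomial in the first `t + 1` variables that involves `z t` ends in it, hence lies in
the tail ideal; the induction descends from `t = m`. -/
theorem exists_headSpan_add_tailSpan
    (hspan : Submodule.span k ((fun α => orderedMon z α m) '' exponents m) = ⊤) {t : ℕ}
    (ht : t ≤ m) (u : A) : ∃ q ∈ headSpan k z m t, u - q ∈ tailSpan z m t := by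
  induction ht using Nat.decreasingInduction with
  | self =>
    refine ⟨u, ?_, by rw [sub_self]; exact zero_mem _⟩
    rw [headSpan, hspan]
    exact Submodule.mem_top
  | of_succ t ht ih =>
    obtain ⟨q, hq, hu⟩ := ih
    have key : ∀ q ∈ headSpan k z m (t + 1), ∃ q' ∈ headSpan k z m t,
        q - q' ∈ tailSpan z m t := by
      intro q hq
      induction hq using Submodule.span_induction with
      | mem q hq =>
        obtain ⟨α, hα, rfl⟩ := hq
        by_cases h0 : α t = 0
        · refine ⟨_, Submodule.subset_span ⟨α, fun l hl => ?_, rfl⟩,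
            by rw [sub_self]; exact zero_mem _⟩
          rcases hl.eq_or_lt with rfl | hl
          · exact h0
          · exact hα l hl
        · refine ⟨0, zero_mem _, ?_⟩
          dsimp only
          rw [sub_zero, orderedMon_of_support z ht hα, orderedMon_succ,
            ← Nat.succ_pred_eq_of_ne_zero h0, pow_succ, ← mul_assoc]
          exact Submodule.smul_mem _ _ (mem_tailSpan z m le_rfl ht)
      | zero => exact ⟨0, zero_mem _, by rw [sub_self]; exact zero_mem _⟩
      | add u v _ _ hu hv =>
        obtain ⟨u', hu', hu⟩ := hu
        obtain ⟨v', hv', hv⟩ := hv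
        refine ⟨u' + v', add_mem hu' hv', ?_⟩
        rw [add_sub_add_comm]
        exact add_mem hu hv
      | smul a u _ hu =>
        obtain ⟨u', hu', hu⟩ := hu
        refine ⟨a • u', Submodule.smul_mem _ _ hu', ?_⟩
        rw [← smul_sub, ← algebraMap_smul A]
        exact Submodule.smul_mem _ _ hu
    obtain ⟨q', hq', h⟩ := key q hq
    refine ⟨q', hq', ?_⟩
    have := add_mem (tailSpan_mono z m (Nat.le_succ t) hu) h
    rwa [sub_add_sub_cancel] at this

variable {s : ℕ} (hcomm : ∀ t, s ≤ t → ∀ j, t < j → j < m → z j * z t ∈ tailSpan z m (t + 1))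
include hcomm

theorem tailSpan_mul {t : ℕ} (hs : s ≤ t) {u : A} (hu : u ∈ tailSpan z m (t + 1)) :
    u * z t ∈ tailSpan z m (t + 1) := by
  induction hu using Submodule.span_induction with
  | mem u hu =>
    obtain ⟨j, hj, rfl⟩ := hu
    exact hcomm t hs j hj.1 hj.2
  | zero => rw [zero_mul]; exact zero_mem _
  | add u v _ _ hu hv => rw [add_mul]; exact add_mem hu hv
  | smul b u _ hu => rw [smul_mul_assoc]; exact Submodule.smul_mem _ b hu

variable (hspan : Submodule.span k ((fun α => orderedMon z α m) '' exponents m) = ⊤)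
  (hind : LinearIndepOn k (fun α => orderedMon z α m) (exponents m))
include hspan hind

/-- Modulo the next tail ideal, `p` equals some `q * z t` with `q` in the next head span, and by
descending induction this is an equality. All monomials of `q * z t` involve `z t` and none of `p`
do, so independence gives zero. -/
theorem headSpan_inf_tailSpan {t : ℕ} (hs : s ≤ t) (ht : t ≤ m) : ∀ p ∈ headSpan k z m t,
    p ∈ tailSpan z m t → p = 0 := by
  induction ht using Nat.decreasingInduction with
  | self =>
    intro p _ hp
    rwa [tailSpan_self, Submodule.mem_bot] at hp
  | of_succ t ht ih =>
    intro p hp hp'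
    obtain ⟨v, hv⟩ := exists_of_mem_tailSpan z m ht hp'
    obtain ⟨q, hq, hvq⟩ := exists_headSpan_add_tailSpan hspan (t := t + 1) ht v
    have h1 : p - q * z t ∈ tailSpan z m (t + 1) := by
      convert add_mem hv (tailSpan_mul hcomm hs hvq) using 1
      rw [sub_mul]
      abel
    have h2 := ih (by omega) _
      (sub_mem (headSpan_mono z m (Nat.le_succ t) hp) (headSpan_mul_mem ht hq)) h1
    have h3 := headSpan_mul ht hq
    rw [← sub_eq_zero.1 h2] at h3
    have hdis : Disjoint (exponents t) {α ∈ exponents (t + 1) | α t ≠ 0} :=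
      Set.disjoint_left.2 fun α hα hα' => hα'.2 (hα t le_rfl)
    have hsub : exponents t ∪ {α ∈ exponents (t + 1) | α t ≠ 0} ⊆ exponents m :=
      Set.union_subset (exponents_mono ht.le) fun α hα => exponents_mono ht hα.1
    have hd := ((linearIndepOn_union_iff hdis).1 (hind.mono hsub)).2.2
    exact Submodule.disjoint_def.1 hd p hp h3

/-- The head span represents the quotient by the tail ideal, and there right multiplication by `z t`
merely raises one exponent, an injective operation on monomials. -/
theorem mem_tailSpan_of_mul_mem {t : ℕ} (hs : s ≤ t) (ht : t < m) {u : A}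
    (hu : u * z t ∈ tailSpan z m (t + 1)) : u ∈ tailSpan z m (t + 1) := by
  obtain ⟨q, hq, huq⟩ := exists_headSpan_add_tailSpan hspan (t := t + 1) ht u
  have h1 : q * z t ∈ tailSpan z m (t + 1) := by
    convert sub_mem hu (tailSpan_mul hcomm hs huq) using 1
    rw [sub_mul]
    abel
  have h2 := headSpan_inf_tailSpan hcomm hspan hind (hs.trans (Nat.le_succ t)) ht _
    (headSpan_mul_mem ht hq) h1
  have h3 : q = 0 := by
    rw [headSpan, Finsupp.mem_span_image_iff_linearCombination] at hq
    obtain ⟨l, hl, rfl⟩ := hq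
    have h4 : Finsupp.linearCombination k (fun α => orderedMon z α m) l * z t =
        Finsupp.linearCombination k (fun α => orderedMon z α m)
          (l.mapDomain (· + Finsupp.single t 1)) := by
      rw [Finsupp.linearCombination_mapDomain, Finsupp.linearCombination_apply,
        Finsupp.linearCombination_apply, Finsupp.sum_mul]
      refine Finsupp.sum_congr fun α hα => ?_
      rw [smul_mul_assoc, orderedMon_mul z ht fun r hr => hl hα r hr]
      rfl
    rw [h4] at h2
    have h5 := linearIndepOn_iff.1 hind _ (by
      intro β hβ
      obtain ⟨α, hα, rfl⟩ := Finset.mem_image.1 (Finsupp.mapDomain_support hβ)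
      exact exponents_mono ht (add_single_mem_exponents (hl hα))) h2
    have h6 : l = 0 := Finsupp.mapDomain_injective (add_left_injective _)
      (h5.trans Finsupp.mapDomain_zero.symm)
    rw [h6, map_zero]
  rwa [h3, sub_zero] at huq

end Regularity

end VermaDuality

end

noncomputable section

namespace VermaDuality

attribute [local instance 100] LieRing.ofAssociativeRing

/-! ### Regular sequences in enveloping algebras -/

section EnvelopingRegular

open UniversalEnvelopingAlgebra

variable {k L : Type*} [Field k] [LieRing L] [LieAlgebra k L]

/-- The linear map `w ↦ w - χ(w)` from `L` to `U(L)`. -/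
def shiftedι (χ : Module.Dual k L) : L →ₗ[k] UniversalEnvelopingAlgebra k L :=
  (ι k : L →ₗ⁅k⁆ UniversalEnvelopingAlgebra k L).toLinearMap - Algebra.linearMap k _ ∘ₗ χ

theorem shiftedι_apply (χ : Module.Dual k L) (w : L) :
    shiftedι χ w = ι k w - algebraMap k _ (χ w) := rfl

theorem antipode_ι (w : L) : antipode k L (ι k w) = MulOpposite.op (-(ι k w)) :=
  UniversalEnvelopingAlgebra.lift_ι_apply _ _ _

theorem antipode_shiftedι (χ : Module.Dual k L) (w : L) :
    antipode k L (shiftedι χ w) = MulOpposite.op (-(shiftedι (-χ) w)) := by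
  rw [shiftedι_apply, shiftedι_apply, map_sub, antipode_ι, AlgHom.commutes, LinearMap.neg_apply,
    map_neg, MulOpposite.algebraMap_apply, ← MulOpposite.op_sub]
  congr 1
  abel

theorem antipode_antipode (u : UniversalEnvelopingAlgebra k L) :
    (antipode k L (antipode k L u).unop).unop = u := by
  let T : UniversalEnvelopingAlgebra k L →ₐ[k] UniversalEnvelopingAlgebra k L :=
    { toFun u := (antipode k L (antipode k L u).unop).unop
      map_one' := by simp
      map_zero' := by simp
      map_add' u v := by simp
      map_mul' u v := by simp
      commutes' c := by
        simp only [AlgHom.commutes, MulOpposite.algebraMap_apply, MulOpposite.unop_op] }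
  have h : T = AlgHom.id k _ := by
    apply UniversalEnvelopingAlgebra.hom_ext
    ext w
    change (antipode k L (antipode k L (ι k w)).unop).unop = ι k w
    rw [antipode_ι, MulOpposite.unop_op, map_neg, antipode_ι, MulOpposite.unop_neg,
      MulOpposite.unop_op, neg_neg]
  exact congrArg (fun f => f u) h

theorem antipode_mem_leftSpan {χ : Module.Dual k L} {y : ℕ → L} {i : ℕ}
    {u : UniversalEnvelopingAlgebra k L} (hu : u ∈ rightSpan (fun j => shiftedι χ (y j)) i) :
    (antipode k L u).unop ∈ leftSpan (fun j => shiftedι (-χ) (y j)) i := by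
  induction hu using Submodule.span_induction with
  | mem u hu =>
    obtain ⟨j, hj, rfl⟩ := hu
    dsimp only
    rw [antipode_shiftedι, MulOpposite.unop_op]
    exact neg_mem (mem_leftSpan (fun j => shiftedι (-χ) (y j)) hj)
  | zero => rw [map_zero]; exact zero_mem _
  | add u v _ _ hu hv => rw [map_add]; exact add_mem hu hv
  | smul a u _ hu =>
    rw [show a • u = u * a.unop from rfl, map_mul]
    exact Submodule.smul_mem _ _ hu

theorem antipode_mem_rightSpan {χ : Module.Dual k L} {y : ℕ → L} {i : ℕ}
    {u : UniversalEnvelopingAlgebra k L} (hu : u ∈ leftSpan (fun j => shiftedι (-χ) (y j)) i) :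
    (antipode k L u).unop ∈ rightSpan (fun j => shiftedι χ (y j)) i := by
  induction hu using Submodule.span_induction with
  | mem u hu =>
    obtain ⟨j, hj, rfl⟩ := hu
    dsimp only
    rw [antipode_shiftedι, MulOpposite.unop_op, neg_neg]
    exact neg_mem (mem_rightSpan (fun j => shiftedι χ (y j)) hj)
  | zero => rw [map_zero]; exact zero_mem _
  | add u v _ _ hu hv => rw [map_add]; exact add_mem hu hv
  | smul a u _ hu =>
    rw [smul_eq_mul, map_mul]
    exact Submodule.smul_mem _ (antipode k L a) hu

theorem antipode_mem_rightSpan_iff {χ : Module.Dual k L} {y : ℕ → L} {i : ℕ}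
    {u : UniversalEnvelopingAlgebra k L} :
    (antipode k L u).unop ∈ rightSpan (fun j => shiftedι χ (y j)) i ↔
      u ∈ leftSpan (fun j => shiftedι (-χ) (y j)) i := by
  refine ⟨fun h => ?_, antipode_mem_rightSpan⟩
  have := antipode_mem_leftSpan h
  rwa [antipode_antipode] at this

theorem shiftedι_mem_leftSpan {χ : Module.Dual k L} {y : ℕ → L} {i : ℕ} {w : L}
    (hw : w ∈ Submodule.span k (y '' Set.Iio i)) :
    shiftedι χ w ∈ leftSpan (fun j => shiftedι χ (y j)) i := by
  induction hw using Submodule.span_induction with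
  | mem w hw =>
    obtain ⟨j, hj, rfl⟩ := hw
    exact mem_leftSpan (fun j => shiftedι χ (y j)) hj
  | zero => rw [map_zero]; exact zero_mem _
  | add u v _ _ hu hv => rw [map_add]; exact add_mem hu hv
  | smul a u _ hu =>
    rw [map_smul, ← algebraMap_smul (UniversalEnvelopingAlgebra k L)]
    exact Submodule.smul_mem _ _ hu

variable {χ : Module.Dual k L} {y : ℕ → L} {γ : ℕ → ℕ → k} {n : ℕ}

/-- Since `χ` kills the brackets, the difference is exactly the shifted image of `⁅y j, y a⁆ + γ a j
• y j`. -/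
theorem shiftedι_commutator
    (hy : ∀ a < n, ∀ j < n, ⁅y j, y a⁆ + γ a j • y j ∈ Submodule.span k (y '' Set.Iio j))
    (hχ : ∀ a < n, ∀ j < n, χ ⁅y j, y a⁆ = 0) :
    ∀ a < n, ∀ j < n, shiftedι χ (y j) * shiftedι χ (y a) -
      (shiftedι χ (y a) - algebraMap k _ (γ a j)) * shiftedι χ (y j) ∈
        leftSpan (fun j => shiftedι χ (y j)) j := by
  intro a ha j hj
  have h := shiftedι_mem_leftSpan (χ := χ) (hy a ha j hj)
  convert h using 1
  rw [map_add, map_smul, shiftedι_apply χ ⁅y j, y a⁆, hχ a ha j hj, map_zero, sub_zero,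
    LieHom.map_lie, LieRing.of_associative_ring_bracket, Algebra.smul_def]
  simp only [shiftedι_apply, sub_mul, mul_sub]
  rw [Algebra.commutes (χ (y j)) (ι k (y a)), Algebra.commutes (χ (y a)) (ι k (y j)),
    Algebra.commutes (χ (y a)) (algebraMap k _ (χ (y j)))]
  abel

variable [CharZero k] [FiniteDimensional k L]

theorem mem_leftSpan_of_mul_mem (hι : Function.Injective (ι k : L →ₗ⁅k⁆ _))
    (hli : LinearIndependent k fun i : Fin n => y i)
    (hy : ∀ a < n, ∀ j < n, ⁅y j, y a⁆ + γ a j • y j ∈ Submodule.span k (y '' Set.Iio j))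
    (hχ : ∀ a < n, ∀ j < n, χ ⁅y j, y a⁆ = 0) {i : ℕ} (hi : i < n)
    {u : UniversalEnvelopingAlgebra k L}
    (hu : u * shiftedι χ (y i) ∈ leftSpan (fun j => shiftedι χ (y j)) i) :
    u ∈ leftSpan (fun j => shiftedι χ (y j)) i := by
  -- The `y i` are put in reverse order at the end of a basis of `L`, so that the left ideal of an
  -- initial segment of `y` is a tail ideal: `y i` gets index `d + n - 1 - i`.
  have hrev : LinearIndependent k fun i : Fin n => y (Fin.rev i) :=
    hli.comp Fin.rev Fin.rev_injective
  let B₀ := Module.Basis.sumExtend hrev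
  have := Module.Finite.finite_basis B₀
  have : Finite (Module.Basis.sumExtendIndex hrev) :=
    Finite.of_injective (Sum.inr : _ → Fin n ⊕ Module.Basis.sumExtendIndex hrev)
      Sum.inr_injective
  obtain ⟨d, ⟨e⟩⟩ := Finite.exists_equiv_fin (Module.Basis.sumExtendIndex hrev)
  let B : Module.Basis (Fin (d + n)) k L := B₀.reindex
    ((Equiv.sumComm _ _).trans ((Equiv.sumCongr e (Equiv.refl _)).trans finSumFinEquiv))
  have hB : ∀ i : Fin n, B (Fin.natAdd d i) = y (Fin.rev i) := by
    intro i
    have h1 : B₀ (Sum.inl i) = y (Fin.rev i) := by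
      simp only [B₀, Module.Basis.sumExtend, Module.Basis.reindex_apply,
        Module.Basis.extend_apply_self]
      rfl
    rw [← h1]
    simp [B]
  let z : ℕ → UniversalEnvelopingAlgebra k L := fun j =>
    if h : j < d + n then shiftedι χ (B ⟨j, h⟩) else 0
  have hz : ∀ j : Fin (d + n), z j = ι k (B j) - algebraMap k _ (χ (B j)) := fun j => by
    simp only [z, dif_pos j.2, shiftedι_apply]
  have hzy : ∀ i < n, z (d + n - 1 - i) = shiftedι χ (y i) := by
    intro i hi
    have h1 := hB ⟨n - 1 - i, by omega⟩
    simp only [z, dif_pos (show d + n - 1 - i < d + n by omega)]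
    have h2 : (⟨d + n - 1 - i, by omega⟩ : Fin (d + n)) = Fin.natAdd d ⟨n - 1 - i, by omega⟩ :=
      Fin.ext (by simp; omega)
    rw [h2, h1, Fin.val_rev]
    congr 2
    simp
    omega
  have htail : ∀ i ≤ n, tailSpan z (d + n) (d + n - i) =
      leftSpan (fun j => shiftedι χ (y j)) i := by
    intro i hi
    rw [tailSpan, leftSpan]
    congr 1
    ext w
    constructor
    · rintro ⟨j, ⟨hj1, hj2⟩, rfl⟩
      refine ⟨d + n - 1 - j, by simp; omega, ?_⟩
      dsimp only
      rw [← hzy _ (by omega)]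
      congr 1
      omega
    · rintro ⟨j, hj, rfl⟩
      have hj : j < i := hj
      exact ⟨d + n - 1 - j, ⟨by omega, by omega⟩, hzy j (by omega)⟩
  have hcomm : ∀ t, d ≤ t → ∀ j, t < j → j < d + n → z j * z t ∈ tailSpan z (d + n) (t + 1) := by
    intro t ht j htj hj
    have h1 := shiftedι_commutator hy hχ (d + n - 1 - t) (by omega) (d + n - 1 - j) (by omega)
    rw [← htail _ (by omega), ← hzy _ (by omega), ← hzy _ (by omega)] at h1
    rw [show d + n - 1 - (d + n - 1 - t) = t by omega,
      show d + n - 1 - (d + n - 1 - j) = j by omega] at h1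
    have h2 := tailSpan_mono z (d + n) (show t + 1 ≤ d + n - (d + n - 1 - j) by omega) h1
    have h3 := Submodule.smul_mem _ (z t - algebraMap k _ (γ (d + n - 1 - t) (d + n - 1 - j)))
      (mem_tailSpan z (d + n) (show t + 1 ≤ j by omega) hj)
    have h4 := add_mem h2 h3
    rwa [smul_eq_mul, sub_add_cancel] at h4
  rw [← htail i hi.le, ← hzy i hi, show d + n - i = d + n - 1 - i + 1 by omega] at hu
  rw [← htail i hi.le, show d + n - i = d + n - 1 - i + 1 by omega]
  exact mem_tailSpan_of_mul_mem hcomm (span_orderedMon B hz) (linearIndepOn_orderedMon B hz hι)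
    (by omega) (by omega) hu

/-- The antipode exchanges left and right ideals and replaces `χ` by `-χ`, which satisfies the same
hypothesis. -/
theorem mem_rightSpan_of_mul_mem (hι : Function.Injective (ι k : L →ₗ⁅k⁆ _))
    (hli : LinearIndependent k fun i : Fin n => y i)
    (hy : ∀ a < n, ∀ j < n, ⁅y j, y a⁆ + γ a j • y j ∈ Submodule.span k (y '' Set.Iio j))
    (hχ : ∀ a < n, ∀ j < n, χ ⁅y j, y a⁆ = 0) {i : ℕ} (hi : i < n)
    {u : UniversalEnvelopingAlgebra k L}
    (hu : shiftedι χ (y i) * u ∈ rightSpan (fun j => shiftedι χ (y j)) i) :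
    u ∈ rightSpan (fun j => shiftedι χ (y j)) i := by
  have h1 := antipode_mem_leftSpan hu
  rw [map_mul, antipode_shiftedι, MulOpposite.unop_mul, MulOpposite.unop_op, mul_neg,
    neg_mem_iff] at h1
  have h2 := antipode_mem_rightSpan (mem_leftSpan_of_mul_mem hι hli hy
    (χ := -χ) (fun a ha j hj => by rw [LinearMap.neg_apply, hχ a ha j hj, neg_zero]) hi h1)
  rwa [antipode_antipode] at h2

end EnvelopingRegular

/-! ### Ext of cyclic modules over an enveloping algebra -/

section EnvelopingDual

open UniversalEnvelopingAlgebra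

variable {k : Type*} {L : Type*} [Field k] [LieRing L] [LieAlgebra k L]
  {χ χ' : Module.Dual k L} {y : ℕ → L} {γ : ℕ → ℕ → k} {n : ℕ} [CharZero k]
  [FiniteDimensional k L]

/-- Duality for the quotient of `U(L)` by the left ideal generated by the `y_j - χ(y_j)`, where
the subspaces spanned by the initial segments of `y` are stable under all the `y_a`. -/
theorem dualCyclic_enveloping (hι : Function.Injective (ι k : L →ₗ⁅k⁆ _))
    (hli : LinearIndependent k fun i : Fin n => y i)
    (hy : ∀ a < n, ∀ j < n, ⁅y j, y a⁆ + γ a j • y j ∈ Submodule.span k (y '' Set.Iio j))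
    (hχ : ∀ a < n, ∀ j < n, χ ⁅y j, y a⁆ = 0)
    (hχ' : ∀ a < n, ∀ j < n, χ' ⁅y j, y a⁆ = 0)
    (htr : ∀ a < n, χ' (y a) = χ (y a) + ∑ l ∈ Finset.range a, γ a l) :
    ∃ D, DualCyclic (ModuleCat.of (UniversalEnvelopingAlgebra k L)
      (UniversalEnvelopingAlgebra k L ⧸ leftSpan (fun j => shiftedι χ (y j)) n)) n
      (rightSpan (fun j => shiftedι χ' (y j)) n) D := by
  have hx' : ∀ i < n, traceShift (fun j => shiftedι χ (y j)) γ i = shiftedι χ' (y i) := by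
    intro i hi
    rw [traceShift, shiftedι_apply, shiftedι_apply, htr i hi, map_add, sub_sub]
  have hR : ∀ i ≤ n, rightSpan (traceShift (fun j => shiftedι χ (y j)) γ) i =
      rightSpan (fun j => shiftedι χ' (y j)) i := by
    intro i hi
    rw [rightSpan, rightSpan]
    congr 1
    exact Set.image_congr fun j hj => hx' j (lt_of_lt_of_le hj hi)
  rw [← hR n le_rfl]
  refine ⟨_, dualCyclic_leftSpan (shiftedι_commutator hy hχ)
    (fun i hi u => mem_leftSpan_of_mul_mem hι hli hy hχ hi) (fun i hi u hu => ?_) le_rfl⟩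
  rw [hR i hi.le] at hu ⊢
  rw [hx' i hi] at hu
  exact mem_rightSpan_of_mul_mem hι hli hy hχ' hi hu

end EnvelopingDual

end VermaDuality

end

noncomputable section

namespace VermaDuality

attribute [local instance 100] LieRing.ofAssociativeRing

/-! ### Reductive Lie algebras -/

section CentralExtension

open LieAlgebra

variable {F g Q : Type*} [Field F] [LieRing g] [LieAlgebra F g] [LieRing Q] [LieAlgebra F Q]
  {π : g →ₗ⁅F⁆ Q} (hπ : Function.Surjective π) (hker : ∀ x, π x = 0 ↔ ∀ y : g, ⁅y, x⁆ = 0)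

include hπ hker

/-- The preimage of a solvable ideal is solvable, with one more derived step for the central kernel,
so it lies in the radical, which is the centre, and its image is zero. -/
theorem hasTrivialRadical_of_surjective [FiniteDimensional F g] [HasCentralRadical F g] :
    HasTrivialRadical F Q := by
  refine hasTrivialRadical_of_no_solvable_ideals fun I hI => ?_
  obtain ⟨k, hk⟩ := IsSolvable.solvable F I
  rw [LieIdeal.derivedSeries_eq_bot_iff] at hk
  have h1 : ∀ k, derivedSeriesOfIdeal F g k (I.comap π) ≤
      (derivedSeriesOfIdeal F Q k I).comap π := by
    intro k
    induction k with
    | zero => rw [derivedSeriesOfIdeal_zero, derivedSeriesOfIdeal_zero]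
    | succ k ih =>
      rw [derivedSeriesOfIdeal_succ, derivedSeriesOfIdeal_succ]
      exact (LieSubmodule.mono_lie ih ih).trans (LieIdeal.comap_bracket_le π)
  have h2 : derivedSeriesOfIdeal F g (k + 1) (I.comap π) = ⊥ := by
    rw [derivedSeriesOfIdeal_succ, LieSubmodule.lie_eq_bot_iff]
    intro x _ y hy
    have h3 := h1 k hy
    rw [hk, LieIdeal.mem_comap, LieSubmodule.mem_bot] at h3
    exact (hker y).1 h3 x
  have h3 : IsSolvable (I.comap π) :=
    IsSolvable.mk (R := F) ((LieIdeal.derivedSeries_eq_bot_iff _ _).2 h2)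
  rw [LieIdeal.solvable_iff_le_radical F, HasCentralRadical.radical_eq_center] at h3
  rw [eq_bot_iff]
  intro x hx
  obtain ⟨x, rfl⟩ := hπ x
  have h4 := h3 (LieIdeal.mem_comap.2 hx)
  rw [LieSubmodule.mem_bot]
  exact (hker x).2 fun y => (LieModule.mem_maxTrivSubmodule F g g x).1 h4 y

/-- A functional on the centre of a Lie algebra with semisimple adjoint quotient extends to a
character. -/
theorem exists_character_eq_on_ker [FiniteDimensional F Q] [IsKilling F Q]
    (ζ : Module.Dual F g) :
    ∃ χ : Module.Dual F g, (∀ x y : g, χ ⁅x, y⁆ = 0) ∧ ∀ x, π x = 0 → χ x = ζ x := by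
  obtain ⟨s, hs⟩ := (π : g →ₗ[F] Q).exists_rightInverse_of_surjective
    (LinearMap.range_eq_top.2 hπ)
  have hs' : ∀ q, π (s q) = q := fun q => LinearMap.congr_fun hs q
  have hlie : ∀ x y u v : g, π x = π y → π u = π v → ⁅x, u⁆ = ⁅y, v⁆ := by
    intro x y u v h1 h2
    have h3 := (hker (u - v)).1 (by rw [map_sub, h2, sub_self]) x
    have h4 := (hker (x - y)).1 (by rw [map_sub, h1, sub_self]) v
    rw [lie_sub, sub_eq_zero] at h3
    rw [lie_sub, sub_eq_zero, ← lie_skew, ← lie_skew v y, neg_inj] at h4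
    rw [h3, h4]
  -- The 2-cocycle of the central extension, pushed forward along `ζ`. Writing it as `κ(D x, y)` for
  -- the Killing form `κ`, the cocycle identity makes `D` a derivation.
  let Ω : LinearMap.BilinForm F Q := LinearMap.mk₂ F (fun x y => ζ (⁅s x, s y⁆ - s ⁅x, y⁆))
    (fun x y z => by simp only [map_add, add_lie, map_sub]; ring)
    (fun c x y => by simp only [map_smul, smul_lie, map_sub, smul_eq_mul]; ring)
    (fun x y z => by simp only [map_add, lie_add, map_sub]; ring)
    (fun c x y => by simp only [map_smul, lie_smul, map_sub, smul_eq_mul]; ring)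
  have hΩ : ∀ x y, Ω x y = ζ ⁅s x, s y⁆ - ζ (s ⁅x, y⁆) := fun x y =>
    map_sub ζ _ _
  have hnd : (killingForm F Q).Nondegenerate := IsKilling.killingForm_nondegenerate F Q
  obtain ⟨D, hD⟩ : ∃ D : Q →ₗ[F] Q, ∀ x y, killingForm F Q (D x) y = Ω x y := by
    refine ⟨((killingForm F Q).toDual hnd).symm.toLinearMap ∘ₗ Ω, fun x y => ?_⟩
    exact LinearMap.BilinForm.apply_toDual_symm_apply (hB := hnd) (f := Ω x) y
  have hinv : ∀ x y z, killingForm F Q ⁅x, y⁆ z = killingForm F Q x ⁅y, z⁆ :=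
    LieModule.traceForm_apply_lie_apply F Q Q
  have hcoc : ∀ x y z, Ω ⁅x, y⁆ z - Ω x ⁅y, z⁆ + Ω y ⁅x, z⁆ = 0 := by
    intro x y z
    have h1 : ⁅s ⁅x, y⁆, s z⁆ = ⁅⁅s x, s y⁆, s z⁆ :=
      hlie _ _ _ _ (by rw [hs', LieHom.map_lie, hs', hs']) rfl
    have h2 : ⁅s x, s ⁅y, z⁆⁆ = ⁅s x, ⁅s y, s z⁆⁆ :=
      hlie _ _ _ _ rfl (by rw [hs', LieHom.map_lie, hs', hs'])
    have h3 : ⁅s y, s ⁅x, z⁆⁆ = ⁅s y, ⁅s x, s z⁆⁆ :=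
      hlie _ _ _ _ rfl (by rw [hs', LieHom.map_lie, hs', hs'])
    rw [hΩ, hΩ, hΩ, h1, h2, h3, lie_lie, lie_lie]
    simp only [map_sub]
    ring
  let D' : LieDerivation F Q Q := ⟨D, fun x y => by
    refine sub_eq_zero.1 (hnd.1 _ fun z => ?_)
    have h1 := hcoc x y z
    rw [← hD, ← hD, ← hD, ← hinv, ← hinv] at h1
    rw [← lie_skew y (D x)]
    simp only [map_sub, map_neg, LinearMap.sub_apply, LinearMap.neg_apply]
    rw [← lie_skew x (D y)]
    simp only [map_neg, LinearMap.neg_apply]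
    linear_combination h1⟩
  obtain ⟨d, hd⟩ := LieDerivation.IsKilling.exists_eq_ad D'
  have hd' : ∀ x, D x = ⁅d, x⁆ := fun x => by
    have := congrArg (fun f : LieDerivation F Q Q => f x) hd
    exact this.symm.trans (LieDerivation.ad_apply_apply F Q d x)
  -- As `D = ad d`, invariance gives `Ω x y = κ(d, ⁅x, y⁆)`, so the cocycle is a coboundary;
  -- subtracting its primitive makes the functional vanish on brackets.
  refine ⟨ζ - ζ ∘ₗ s ∘ₗ (π : g →ₗ[F] Q) - (killingForm F Q d) ∘ₗ (π : g →ₗ[F] Q), ?_, ?_⟩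
  · intro x y
    have h1 : ⁅s (π x), s (π y)⁆ = ⁅x, y⁆ := hlie _ _ _ _ (hs' _) (hs' _)
    have h2 := hΩ (π x) (π y)
    rw [← hD, hd', hinv, h1] at h2
    change ζ ⁅x, y⁆ - ζ (s (π ⁅x, y⁆)) - killingForm F Q d (π ⁅x, y⁆) = 0
    rw [LieHom.map_lie, h2, sub_self]
  · intro x hx
    change ζ x - ζ (s (π x)) - killingForm F Q d (π x) = ζ x
    rw [hx, map_zero, map_zero, map_zero, sub_zero, sub_zero]

end CentralExtension

/-! ### Embedding a reductive Lie algebra in its enveloping algebra -/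

section Reductive

open LieAlgebra

universe u v

variable (F : Type u) (g : Type v) [Field F] [LieRing g] [LieAlgebra F g]

/-- The quotient morphism from `g` to its adjoint quotient. -/
def toAdjointQuotient : g →ₗ⁅F⁆ g ⧸ center F g where
  toLinearMap := (LieSubmodule.Quotient.mk' (center F g)).toLinearMap
  map_lie' {_ _} := rfl

variable {F g} in
theorem toAdjointQuotient_eq_zero_iff (x : g) :
    toAdjointQuotient F g x = 0 ↔ ∀ y : g, ⁅y, x⁆ = 0 :=
  (LieSubmodule.Quotient.mk_eq_zero (N := center F g)).trans (LieModule.mem_maxTrivSubmodule F g g x)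

theorem toAdjointQuotient_surjective : Function.Surjective (toAdjointQuotient F g) :=
  LieSubmodule.Quotient.surjective_mk' _

variable [CharZero F] [FiniteDimensional F g] [HasCentralRadical F g]

instance : FiniteDimensional F (g ⧸ center F g) :=
  inferInstanceAs (FiniteDimensional F (g ⧸ (center F g).toSubmodule))

instance : HasTrivialRadical F (g ⧸ center F g) :=
  hasTrivialRadical_of_surjective (toAdjointQuotient_surjective F g) toAdjointQuotient_eq_zero_iff

/-- A reductive Lie algebra embeds into an associative algebra. -/
theorem exists_injective_lieHom :
    ∃ (A : Type (max u v)) (_ : Ring A) (_ : Algebra F A) (f : g →ₗ⁅F⁆ A), Function.Injective f := by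
  -- The adjoint representation has the centre as kernel, and the characters separate central
  -- elements.
  refine ⟨Module.End F g × ({χ : Module.Dual F g // ∀ x y : g, χ ⁅x, y⁆ = 0} → F), inferInstance,
    inferInstance,
    { toFun x := (LieAlgebra.ad F g x, fun χ => χ.1 x)
      map_add' x y := by ext <;> simp
      map_smul' c x := by ext <;> simp
      map_lie' {x y} := by
        rw [LieRing.of_associative_ring_bracket]
        refine Prod.ext ?_ (funext fun χ => ?_)
        · exact (LieAlgebra.ad F g).map_lie x y
        · change χ.1 ⁅x, y⁆ = χ.1 x * χ.1 y - χ.1 y * χ.1 x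
          rw [χ.2, mul_comm, sub_self] }, ?_⟩
  refine (injective_iff_map_eq_zero _).2 fun x hx => ?_
  have h1 : LieAlgebra.ad F g x = 0 := congrArg Prod.fst hx
  have h2 : ∀ χ : Module.Dual F g, (∀ x y : g, χ ⁅x, y⁆ = 0) → χ x = 0 := fun χ hχ =>
    congrFun (congrArg Prod.snd hx) ⟨χ, hχ⟩
  rw [← Module.forall_dual_apply_eq_zero_iff F]
  intro ζ
  obtain ⟨χ, hχ, hχζ⟩ := exists_character_eq_on_ker (toAdjointQuotient_surjective F g)
    toAdjointQuotient_eq_zero_iff ζ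
  rw [← hχζ x ((toAdjointQuotient_eq_zero_iff x).2 fun y => ?_), h2 χ hχ]
  rw [← lie_skew, neg_eq_zero]
  exact LinearMap.congr_fun h1 y

variable {F g} in
/-- The extension of scalars of a morphism to an associative algebra. -/
def liftBaseChangeLie {E A B : Type*} [CommRing E] [Algebra F E] [Ring A] [Algebra F A] [Ring B]
    [Algebra F B] [Algebra E B] [IsScalarTower F E B] (i : A →ₐ[F] B) (f : g →ₗ⁅F⁆ A) :
    E ⊗[F] g →ₗ⁅E⁆ B where
  toLinearMap := (i.toLinearMap ∘ₗ (f : g →ₗ[F] A)).liftBaseChange E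
  map_lie' {x y} := by
    change LinearMap.liftBaseChange E (i.toLinearMap ∘ₗ (f : g →ₗ[F] A)) ⁅x, y⁆ =
      ⁅LinearMap.liftBaseChange E (i.toLinearMap ∘ₗ (f : g →ₗ[F] A)) x,
        LinearMap.liftBaseChange E (i.toLinearMap ∘ₗ (f : g →ₗ[F] A)) y⁆
    induction x with
    | zero => rw [zero_lie, map_zero, zero_lie]
    | add a b ha hb => rw [add_lie, map_add, ha, hb, map_add, add_lie]
    | tmul a u =>
      induction y with
      | zero => rw [lie_zero, map_zero, lie_zero]
      | add a b ha hb => rw [lie_add, map_add, ha, hb, map_add, lie_add]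
      | tmul b v =>
        rw [LieAlgebra.ExtendScalars.bracket_tmul]
        simp only [LinearMap.liftBaseChange_tmul, LinearMap.comp_apply, smul_lie, lie_smul,
          smul_smul]
        rw [mul_comm b a]
        congr 1
        change i (f ⁅u, v⁆) = ⁅i (f u), i (f v)⁆
        rw [LieHom.map_lie, LieRing.of_associative_ring_bracket,
          LieRing.of_associative_ring_bracket, map_sub, map_mul, map_mul]

/-- The canonical map from the base change of a reductive Lie algebra to its enveloping algebra is
injective. -/
theorem injective_ι_baseChange (E : Type*) [Field E] [Algebra F E] :
    Function.Injective (UniversalEnvelopingAlgebra.ι E : E ⊗[F] g →ₗ⁅E⁆ _) := by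
  obtain ⟨A, _, _, f, hf⟩ := exists_injective_lieHom F g
  let i : A →ₐ[F] E ⊗[F] A := Algebra.TensorProduct.includeRight
  have h1 : (i.toLinearMap ∘ₗ (f : g →ₗ[F] A)).liftBaseChange E =
      (f : g →ₗ[F] A).baseChange E := by
    ext x
    simp [i]
  have h2 : Function.Injective ((i.toLinearMap ∘ₗ (f : g →ₗ[F] A)).liftBaseChange E) := by
    rw [h1]
    exact Module.Flat.lTensor_preserves_injective_linearMap (f : g →ₗ[F] A) hf
  intro x y hxy
  apply h2
  have := congrArg (UniversalEnvelopingAlgebra.lift E (liftBaseChangeLie i f)) hxy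
  rwa [UniversalEnvelopingAlgebra.lift_ι_apply, UniversalEnvelopingAlgebra.lift_ι_apply] at this

end Reductive

end VermaDuality

end

noncomputable section

namespace VermaDuality

attribute [local instance 100] LieRing.ofAssociativeRing

/-! ### Root spaces of reductive Lie algebras -/

section CentralQuotient

open LieAlgebra

variable {F g Q : Type*} [Field F] [LieRing g] [LieAlgebra F g] [LieRing Q] [LieAlgebra F Q]
  {π : g →ₗ⁅F⁆ Q} (hπ : Function.Surjective π) (hker : ∀ x, π x = 0 ↔ ∀ y : g, ⁅y, x⁆ = 0)
  {t : LieSubalgebra F g} (ht : IsSplittingCartan t)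

theorem lie_mem_iSup_roots (h : t) {x : g} (hx : x ∈ ⨆ α ∈ roots t, rootSpace t α) :
    ⁅(h : g), x⁆ ∈ ⨆ α ∈ roots t, rootSpace t α := by
  have : (⨆ α ∈ roots t, rootSpace t α) ≤
      (⨆ α ∈ roots t, rootSpace t α).comap (LieModule.toEnd F g g (h : g)) := by
    refine iSup₂_le fun α hα x hx => ?_
    rw [Submodule.mem_comap, LieModule.toEnd_apply_apply, mem_rootSpace.1 hx h]
    exact Submodule.smul_mem _ _ (Submodule.mem_iSup_of_mem α (Submodule.mem_iSup_of_mem hα hx))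
  exact this hx

include hker in
theorem root_eq_zero_of_map_eq_zero {α : Module.Dual F t} (hα : α ∈ roots t) (h : t)
    (hh : π h = 0) : α h = 0 := by
  obtain ⟨x, hx, hx0⟩ := (Submodule.ne_bot_iff _).1 hα.2
  have h1 := mem_rootSpace.1 hx h
  rw [← lie_skew, (hker _).1 hh x, neg_zero] at h1
  exact (smul_eq_zero.1 h1.symm).resolve_right hx0

include hker ht in
theorem mem_of_map_eq_zero {x : g} (hx : π x = 0) : x ∈ t :=
  ht.mem_of_centralizes x fun h _ => (hker x).1 hx h

include hker ht in
theorem map_injOn_rootSpace {α : Module.Dual F t} (hα : α ≠ 0) {x : g} (hx : x ∈ rootSpace t α)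
    (h0 : π x = 0) : x = 0 := by
  have h1 : cartanProj ht x = ⟨x, mem_of_map_eq_zero hker ht h0⟩ := cartanProj_of_mem ht _
  rw [cartanProj_of_mem_rootSpace ht hα hx] at h1
  exact (congrArg Subtype.val h1).symm

include hπ hker ht in
theorem isCartanSubalgebra_map : (t.map π).IsCartanSubalgebra where
  nilpotent := by
    have : IsLieAbelian (t.map π) := ⟨by
      rintro ⟨_, x, hx, rfl⟩ ⟨_, y, hy, rfl⟩
      refine Subtype.ext ?_
      change ⁅π x, π y⁆ = 0
      rw [← LieHom.map_lie, ht.lie_eq_zero x hx y hy, map_zero]⟩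
    infer_instance
  self_normalizing := by
    refine le_antisymm (fun x hx => ?_) (LieSubalgebra.le_normalizer _)
    obtain ⟨x, rfl⟩ := hπ x
    rw [LieSubalgebra.mem_normalizer_iff'] at hx
    obtain ⟨y, hy, z, hz, rfl⟩ := Submodule.mem_sup.1
      ((isCompl_roots ht).sup_eq_top ▸ Submodule.mem_top : x ∈ _)
    -- The bracket of `t` with `z` lies both in `t`, which contains the kernel, and in the sum of
    -- the root spaces. It therefore vanishes, and `z` centralizes `t`.
    have hz0 : z = 0 := by
      have h1 : ∀ h ∈ t, ⁅h, z⁆ = 0 := by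
        intro h hh
        have h2 := hx (π h) ⟨h, hh, rfl⟩
        rw [← LieHom.map_lie, lie_add, ht.lie_eq_zero h hh y hy, zero_add] at h2
        obtain ⟨w, hw, hwz⟩ := h2
        have h3 : ⁅h, z⁆ ∈ t := by
          have h4 : w - ⁅h, z⁆ ∈ t := mem_of_map_eq_zero hker ht (by
            rw [map_sub, sub_eq_zero]; exact hwz)
          have h5 := sub_mem (show w ∈ t from hw) h4
          rwa [sub_sub_cancel] at h5
        exact Submodule.disjoint_def.1 (isCompl_roots ht).disjoint _ h3
          (lie_mem_iSup_roots ⟨h, hh⟩ hz)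
      exact Submodule.disjoint_def.1 (isCompl_roots ht).disjoint _ (ht.mem_of_centralizes z h1) hz
    rw [hz0, add_zero]
    exact ⟨y, hy, rfl⟩

include hπ ht in
theorem iSup_map_rootSpace :
    ⨆ α : Module.Dual F t, (rootSpace t α).map (π : g →ₗ[F] Q) = ⊤ := by
  rw [← Submodule.map_iSup, ht.iSup_rootSpace, Submodule.map_top]
  exact LinearMap.range_eq_top.2 hπ

include hπ ht in
theorem isTriangularizable_map : LieModule.IsTriangularizable F (t.map π) Q where
  maxGenEigenspace_eq_top := by
    rintro ⟨_, h, hh, rfl⟩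
    rw [eq_top_iff, ← iSup_map_rootSpace hπ ht]
    refine iSup_le fun α => le_trans ?_ (le_iSup _ (α ⟨h, hh⟩))
    rintro _ ⟨x, hx, rfl⟩
    refine Module.End.mem_maxGenEigenspace _ _ _ |>.2 ⟨1, ?_⟩
    rw [pow_one, LinearMap.sub_apply, sub_eq_zero]
    change ⁅π h, π x⁆ = α ⟨h, hh⟩ • π x
    rw [← LieHom.map_lie, ← map_smul]
    exact congrArg π (mem_rootSpace.1 hx ⟨h, hh⟩)

variable [CharZero F] [FiniteDimensional F g] [FiniteDimensional F Q] [IsKilling F Q]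

include hπ hker ht in
-- Roots vanish on the central kernel, so `α` descends to a root of `Q` with respect to the image of
-- `t`, and its root space embeds in that of `Q`. The structure theory of Killing Lie algebras then
-- applies; only `h` and `e` are lifted back to `g`.
theorem rootSpace_data {α : Module.Dual F t} (hα : α ∈ roots t) :
    Module.finrank F (rootSpace t α) = 1 ∧
      ∃ h : t, ∃ e ∈ rootSpace t α, ∃ f : Q, IsSl2Triple (π h) (π e) f ∧ α h = 2 := by
  have := isCartanSubalgebra_map hπ hker ht
  have := isTriangularizable_map hπ ht
  let πt : t →ₗ[F] t.map π :=
    ((π : g →ₗ[F] Q) ∘ₗ t.toSubmodule.subtype).codRestrict (t.map π).toSubmodule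
      fun h => ⟨h, h.2, rfl⟩
  have hπt : Function.Surjective πt := by
    rintro ⟨_, h, hh, rfl⟩
    exact ⟨⟨h, hh⟩, rfl⟩
  obtain ⟨s, hs⟩ := πt.exists_rightInverse_of_surjective (LinearMap.range_eq_top.2 hπt)
  have hs' : ∀ h : t, α (s (πt h)) = α h := by
    intro h
    rw [← sub_eq_zero, ← map_sub]
    refine root_eq_zero_of_map_eq_zero hker hα _ ?_
    have h1 : πt (s (πt h) - h) = 0 := by
      rw [map_sub, sub_eq_zero]
      exact LinearMap.congr_fun hs _
    exact congrArg Subtype.val h1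
  let ψ : t.map π → F := fun h => α (s h)
  have hmap : ∀ x ∈ rootSpace t α, π x ∈ LieAlgebra.rootSpace (t.map π) ψ := by
    intro x hx
    refine LieModule.weightSpace_le_genWeightSpace Q ψ ?_
    rw [LieModule.mem_weightSpace]
    intro h
    obtain ⟨h, rfl⟩ := hπt h
    change ⁅π h, π x⁆ = α (s (πt h)) • π x
    rw [hs', ← LieHom.map_lie, ← map_smul]
    exact congrArg π (mem_rootSpace.1 hx h)
  obtain ⟨x, hx, hx0⟩ := (Submodule.ne_bot_iff _).1 hα.2
  have hπx : π x ≠ 0 := fun h => hx0 (map_injOn_rootSpace hker ht hα.1 hx h)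
  let w : LieModule.Weight F (t.map π) Q := ⟨ψ, fun h => hπx (by
    have := hmap x hx
    rw [LieAlgebra.rootSpace, h] at this
    exact (LieSubmodule.mem_bot _).1 this)⟩
  have hw : w.IsNonZero := by
    intro h
    apply hα.1
    ext u
    rw [← hs']
    exact congrFun h (πt u)
  have hone := IsKilling.finrank_rootSpace_eq_one w hw
  let φ : rootSpace t α →ₗ[F] LieAlgebra.rootSpace (t.map π) ψ :=
    ((π : g →ₗ[F] Q) ∘ₗ (rootSpace t α).subtype).codRestrict
      (LieAlgebra.rootSpace (t.map π) ψ).toSubmodule fun x => hmap x x.2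
  have hφ : Function.Injective φ := (injective_iff_map_eq_zero φ).2 fun x hx =>
    Subtype.ext (map_injOn_rootSpace hker ht hα.1 x.2 (congrArg Subtype.val hx))
  have hdim : Module.finrank F (rootSpace t α) = 1 := by
    refine le_antisymm ((LinearMap.finrank_le_finrank_of_injective hφ).trans hone.le) ?_
    exact Submodule.one_le_finrank_iff.2 hα.2
  refine ⟨hdim, ?_⟩
  obtain ⟨h, e, f, htr, he, hf⟩ := IsKilling.exists_isSl2Triple_of_weight_isNonZero hw
  have hh := htr.h_eq_coroot hw he hf
  obtain ⟨h', hh'⟩ := hπt (IsKilling.coroot w)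
  have hφs : Function.Surjective φ :=
    (LinearMap.injective_iff_surjective_of_finrank_eq_finrank (hdim.trans hone.symm)).1 hφ
  obtain ⟨e', he'⟩ := hφs ⟨e, he⟩
  refine ⟨h', e', e'.2, f, ?_, ?_⟩
  · have h1 : π h' = h := by
      rw [hh, ← hh']
      rfl
    have h2 : π e' = e := congrArg Subtype.val he'
    rwa [h1, h2]
  · rw [← hs', hh']
    exact IsKilling.root_apply_coroot hw

end CentralQuotient

/-! ### Positive roots have no vanishing nonempty sums -/

section Positive

open LieAlgebra

variable {F g : Type*} [Field F] [CharZero F] [LieRing g] [LieAlgebra F g]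
  [FiniteDimensional F g] [HasCentralRadical F g] {t b : LieSubalgebra F g}
  (ht : IsSplittingCartan t)

include ht in
theorem finrank_rootSpace {α : Module.Dual F t} (hα : α ∈ roots t) :
    Module.finrank F (rootSpace t α) = 1 :=
  (rootSpace_data (toAdjointQuotient_surjective F g) toAdjointQuotient_eq_zero_iff ht hα).1

variable (hb : IsBorel t b)

omit [CharZero F] [FiniteDimensional F g] [HasCentralRadical F g] in
include ht hb in
theorem mem_posRoots_of_mem {α : Module.Dual F t} (hα : α ≠ 0) {x : g} (hx : x ∈ rootSpace t α)
    (hx0 : x ≠ 0) (hxb : x ∈ b) : α ∈ posRoots t b := by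
  have hα' : α ∈ roots t := ⟨hα, fun h => hx0 (by rw [h] at hx; simpa using hx)⟩
  by_contra hneg
  have h1 : x ∈ ⨆ β ∈ {β | β ≠ α}, rootSpace t β := by
    have h2 : b.toSubmodule ≤ ⨆ β ∈ {β | β ≠ α}, rootSpace t β := by
      rw [hb.eq_sup]
      refine sup_le ?_ (iSup₂_le fun β hβ => ?_)
      · rw [← rootSpace_zero ht]
        exact le_iSup₂_of_le 0 hα.symm le_rfl
      · exact le_iSup₂_of_le β (fun h => hneg (h ▸ hβ)) le_rfl
    exact h2 hxb
  exact hx0 (Submodule.disjoint_def.1 (iSupIndep_rootSpace ht α) x hx h1)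

include ht hb in
/-- If a positive root `β` takes a value which is not a natural number on the coroot of `α`, then
`α + β` is a positive root. -/
theorem exists_coroot {α : Module.Dual F t} (hα : α ∈ posRoots t b) :
    ∃ h : t, α h = 2 ∧ ∀ β ∈ posRoots t b, (∀ n : ℕ, β h ≠ n) → α + β ∈ posRoots t b := by
  obtain ⟨_, h, e, he, f, htr, hαh⟩ :=
    rootSpace_data (toAdjointQuotient_surjective F g) toAdjointQuotient_eq_zero_iff ht hα.1
  refine ⟨h, hαh, fun β hβ hn => ?_⟩
  obtain ⟨v, hv, hv0⟩ := (Submodule.ne_bot_iff _).1 hβ.1.2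
  have hπv : toAdjointQuotient F g v ≠ 0 := fun h =>
    hv0 (map_injOn_rootSpace toAdjointQuotient_eq_zero_iff ht hβ.1.1 hv h)
  have hev : ⁅e, v⁆ ≠ 0 := by
    intro h0
    -- If `e` killed `v`, then `v` would be primitive for the `sl₂`-triple, and its weight `β h` a
    -- natural number.
    have P : htr.HasPrimitiveVectorWith (toAdjointQuotient F g v) (β h) :=
      { ne_zero := hπv
        lie_h := by
          rw [← LieHom.map_lie, ← map_smul]
          exact congrArg _ (mem_rootSpace.1 hv h)
        lie_e := by rw [← LieHom.map_lie, h0, map_zero] }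
    obtain ⟨n, hn'⟩ := P.exists_nat
    exact hn n hn'
  refine mem_posRoots_of_mem ht hb (fun h0 => ?_) (lie_mem_rootSpace he hv) hev
    (b.lie_mem (hα.2 he) (hβ.2 hv))
  rw [(neg_eq_of_add_eq_zero_right h0).symm] at hβ
  rcases hb.pos_xor_neg α hα.1 with h1 | h1
  · exact h1.2 hβ
  · exact h1.2 hα

include ht hb in
/-- A nonempty sum of positive roots does not vanish. -/
theorem sum_posRoots_ne_zero (s : Multiset (Module.Dual F t)) (hs : s ≠ 0)
    (hpos : ∀ α ∈ s, α ∈ posRoots t b) : s.sum ≠ 0 := by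
  classical
  induction hn : s.card using Nat.strong_induction_on generalizing s with
  | _ n ih =>
    subst hn
    intro h0
    obtain ⟨α, hα⟩ := Multiset.exists_mem_of_ne_zero hs
    obtain ⟨s, rfl⟩ := Multiset.exists_cons_of_mem hα
    obtain ⟨h, hαh, hadd⟩ := exists_coroot ht hb (hpos α hα)
    rw [Multiset.sum_cons] at h0
    -- If all other roots take natural values on the coroot of `α`, the sum evaluates there to `2 +
    -- n ≠ 0`. Otherwise some `β` can be merged with `α` into a positive root, giving a smaller
    -- multiset with the same sum.
    by_cases hnat : ∀ β ∈ s, ∃ n : ℕ, β h = n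
    · have key : ∃ n : ℕ, s.sum h = n := by
        clear h0 ih hα hpos hs
        induction s using Multiset.induction_on with
        | empty => exact ⟨0, by simp⟩
        | cons β s ih =>
          obtain ⟨n, hn⟩ := ih fun β hβ => hnat β (Multiset.mem_cons_of_mem hβ)
          obtain ⟨m, hm⟩ := hnat β (Multiset.mem_cons_self β s)
          exact ⟨m + n, by rw [Multiset.sum_cons, LinearMap.add_apply, hn, hm, Nat.cast_add]⟩
      obtain ⟨n, hn⟩ := key
      have h1 := LinearMap.congr_fun h0 h
      rw [LinearMap.add_apply, hαh, hn, LinearMap.zero_apply] at h1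
      exact absurd (by exact_mod_cast h1 : 2 + n = 0) (by omega)
    · push Not at hnat
      obtain ⟨β, hβ, hβn⟩ := hnat
      obtain ⟨s, rfl⟩ := Multiset.exists_cons_of_mem hβ
      refine ih ((α + β) ::ₘ s).card (by simp) _ (Multiset.cons_ne_zero) ?_ rfl ?_
      · intro γ hγ
        rcases Multiset.mem_cons.1 hγ with rfl | hγ
        · exact hadd β (hpos β (by simp)) hβn
        · exact hpos γ (by simp [hγ])
      · rw [Multiset.sum_cons, add_assoc, ← Multiset.sum_cons, h0]

end Positive

end VermaDuality

end

noncomputable section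

namespace VermaDuality

attribute [local instance 100] LieRing.ofAssociativeRing

/-! ### A basis of the Borel subalgebra adapted to a chain of ideals -/

section AdaptedBasis

open LieAlgebra

variable {F g : Type*} [Field F] [CharZero F] [LieRing g] [LieAlgebra F g]
  [FiniteDimensional F g] [HasCentralRadical F g] {t b : LieSubalgebra F g}
  (ht : IsSplittingCartan t) (hb : IsBorel t b)

include ht hb

/-- The positive roots can be numbered so that adding a positive root decreases the index. -/
theorem exists_numbering_posRoots :
    ∃ (N : ℕ) (a : Fin N → Module.Dual F t), Function.Injective a ∧ Set.range a = posRoots t b ∧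
      ∀ i j, ∀ γ ∈ posRoots t b, a j + γ = a i → i < j := by
  classical
  have hfin : (posRoots t b).Finite := (roots_finite ht).subset fun α h => h.1
  let S : Finset (Module.Dual F t) := hfin.toFinset
  let r : Module.Dual F t → Module.Dual F t → Prop := fun β α =>
    ∃ s : Multiset (Module.Dual F t), s ≠ 0 ∧ (∀ γ ∈ s, γ ∈ posRoots t b) ∧ β = α + s.sum
  -- `f α` counts the positive roots strictly above `α`. It drops when a positive root is added,
  -- since `α + γ` is above `α` but not above itself; the numbering sorts by `f`.
  let f : Module.Dual F t → ℕ := fun α => (S.filter fun β => r β α).card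
  have hf : ∀ α, ∀ γ ∈ posRoots t b, α + γ ∈ posRoots t b → f (α + γ) < f α := by
    intro α γ hγ hαγ
    refine Finset.card_lt_card (Finset.ssubset_iff_of_subset ?_ |>.2 ⟨α + γ, ?_, ?_⟩)
    · intro δ hδ
      rw [Finset.mem_filter] at hδ ⊢
      obtain ⟨h1, s, _, hs, rfl⟩ := hδ
      refine ⟨h1, γ ::ₘ s, Multiset.cons_ne_zero, ?_, by rw [Multiset.sum_cons, add_assoc]⟩
      intro δ hδ
      rcases Multiset.mem_cons.1 hδ with rfl | hδ
      · exact hγ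
      · exact hs δ hδ
    · rw [Finset.mem_filter]
      exact ⟨hfin.mem_toFinset.2 hαγ, {γ}, by simp, by simpa using hγ, by simp⟩
    · rw [Finset.mem_filter]
      rintro ⟨_, s, hs0, hs, h⟩
      exact sum_posRoots_ne_zero ht hb s hs0 hs (left_eq_add.1 h)
  let e := S.equivFin.symm
  let σ := Tuple.sort fun i => f (e i)
  have hmono : Monotone ((fun i => f (e i)) ∘ σ) := Tuple.monotone_sort _
  have hmem : ∀ i, (e i : Module.Dual F t) ∈ posRoots t b := fun i =>
    hfin.mem_toFinset.1 (e i).2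
  refine ⟨S.card, fun i => e (σ i), ?_, ?_, ?_⟩
  · exact Subtype.val_injective.comp (e.injective.comp σ.injective)
  · ext α
    refine ⟨?_, fun hα => ?_⟩
    · rintro ⟨i, rfl⟩
      exact hmem _
    · exact ⟨σ.symm (e.symm ⟨α, hfin.mem_toFinset.2 hα⟩), by simp⟩
  · intro i j γ hγ h
    by_contra hij
    have h1 := hmono (not_lt.1 hij)
    have h2 := hf (e (σ j)) γ hγ (h ▸ hmem _)
    rw [h] at h2
    exact absurd h1 (not_le.2 h2)

/-- The Borel subalgebra has a basis whose initial segments span ideals of it, on whose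
successive quotients it acts through weights with partial sums given by `2ρ`. -/
theorem exists_adapted_basis :
    ∃ (y : ℕ → g) (γ : ℕ → ℕ → F),
      LinearIndependent F (fun i : Fin (Module.finrank F b) => y i) ∧
      Submodule.span F (y '' Set.Iio (Module.finrank F b)) = b.toSubmodule ∧
      (∀ a < Module.finrank F b, ∀ j < Module.finrank F b,
        ⁅y j, y a⁆ + γ a j • y j ∈ Submodule.span F (y '' Set.Iio j)) ∧
      ∀ a < Module.finrank F b,
        ∑ l ∈ Finset.range a, γ a l = 2 * rho t b (cartanProj ht (y a)) := by
  obtain ⟨N, α, hinj, hrange, hord⟩ := exists_numbering_posRoots ht hb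
  have hpos : ∀ i, α i ∈ posRoots t b := fun i => hrange ▸ ⟨i, rfl⟩
  have hex : ∀ i, ∃ v ∈ rootSpace t (α i), v ≠ 0 := fun i =>
    (Submodule.ne_bot_iff _).1 (hpos i).1.2
  choose v hv hv0 using hex
  have hspan1 : ∀ i, ∀ x ∈ rootSpace t (α i), ∃ c : F, c • v i = x := by
    intro i x hx
    obtain ⟨c, hc⟩ := (finrank_eq_one_iff_of_nonzero' (⟨v i, hv i⟩ : rootSpace t (α i))
      (fun h => hv0 i (congrArg Subtype.val h))).1 (finrank_rootSpace ht (hpos i).1) ⟨x, hx⟩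
    exact ⟨c, congrArg Subtype.val hc⟩
  let r := Module.finrank F t
  let B : Module.Basis (Fin r) F t := Module.finBasis F t
  let w : Fin N ⊕ Fin r → g := Sum.elim v (fun i => (B i : g))
  have hspanv : Submodule.span F (Set.range v) = ⨆ β ∈ posRoots t b, rootSpace t β := by
    apply le_antisymm
    · rw [Submodule.span_le]
      rintro _ ⟨i, rfl⟩
      exact Submodule.mem_iSup_of_mem (α i) (Submodule.mem_iSup_of_mem (hpos i) (hv i))
    · refine iSup₂_le fun β hβ => ?_
      rw [← hrange] at hβ
      obtain ⟨i, rfl⟩ := hβ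
      intro x hx
      obtain ⟨c, rfl⟩ := hspan1 i x hx
      exact Submodule.smul_mem _ _ (Submodule.subset_span ⟨i, rfl⟩)
  have hspanB : Submodule.span F (Set.range fun i => (B i : g)) = t.toSubmodule := by
    have h1 := congrArg (Submodule.map t.toSubmodule.subtype) B.span_eq
    rw [Submodule.map_span, ← Set.range_comp, Submodule.map_top, Submodule.range_subtype] at h1
    exact h1
  have hspanw : Submodule.span F (Set.range w) = b.toSubmodule := by
    rw [Set.Sum.elim_range, Submodule.span_union, hspanv, hspanB, sup_comm]
    exact hb.eq_sup.symm
  have hliw : LinearIndependent F w := by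
    refine LinearIndependent.sum_type ?_ ?_ ?_
    · exact ((iSupIndep_rootSpace ht).comp hinj).linearIndependent _ hv hv0
    · exact B.linearIndependent.map' t.toSubmodule.subtype (Submodule.ker_subtype _)
    · rw [hspanv, hspanB]
      exact (isCompl_roots ht).disjoint.symm.mono_left
        (biSup_mono fun β hβ => hβ.1)
  have hn : Module.finrank F b = N + r := by
    have h1 := finrank_span_eq_card hliw
    rw [hspanw, Fintype.card_sum, Fintype.card_fin, Fintype.card_fin] at h1
    exact h1
  rw [hn]
  -- Root vectors come first and the Cartan basis last, so that the partial trace at a Cartan index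
  -- already runs over every positive root.
  let y : ℕ → g := fun i => if h : i < N + r then w (finSumFinEquiv.symm ⟨i, h⟩) else 0
  have hy : ∀ k, y (finSumFinEquiv k : Fin (N + r)) = w k := fun k => by simp [y]
  have hcases : ∀ i < N + r, (∃ k : Fin N, i = k ∧ y i = v k) ∨
      ∃ k : Fin r, i = N + k ∧ y i = B k := by
    intro i hi
    obtain ⟨k | k, hk⟩ := finSumFinEquiv.surjective (⟨i, hi⟩ : Fin (N + r))
    · have h1 := hy (Sum.inl k)
      rw [hk] at h1
      exact Or.inl ⟨k, by simpa using (congrArg Fin.val hk).symm, h1⟩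
    · have h1 := hy (Sum.inr k)
      rw [hk] at h1
      exact Or.inr ⟨k, by simpa using (congrArg Fin.val hk).symm, h1⟩
  have hyv : ∀ k : Fin N, y k = v k := fun k => hy (Sum.inl k)
  have hprojv : ∀ k, cartanProj ht (v k) = 0 := fun k =>
    cartanProj_of_mem_rootSpace ht (hpos k).1.1 (hv k)
  have hprojB : ∀ k, cartanProj ht (B k : g) = B k := fun k => cartanProj_of_mem ht (B k).2
  let γ : ℕ → ℕ → F := fun a j => if h : j < N then α ⟨j, h⟩ (cartanProj ht (y a)) else 0
  have hγ1 : ∀ a, ∀ k : Fin N, γ a k = α k (cartanProj ht (y a)) := fun a k => by simp [γ]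
  have hγ2 : ∀ a j, N ≤ j → γ a j = 0 := fun a j h => dif_neg (not_lt.2 h)
  refine ⟨y, γ, ?_, ?_, ?_, ?_⟩
  · convert hliw.comp _ finSumFinEquiv.symm.injective using 1
    funext i
    simp [y]
  · rw [← hspanw]
    congr 1
    ext x
    constructor
    · rintro ⟨i, hi, rfl⟩
      exact ⟨finSumFinEquiv.symm ⟨i, hi⟩, by simp [y, show i < N + r from hi]⟩
    · rintro ⟨k, rfl⟩
      exact ⟨_, (finSumFinEquiv k).2, hy k⟩
  · intro a ha j hj
    rcases hcases j hj with ⟨j, rfl, hyj⟩ | ⟨j, rfl, hyj⟩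
    · rw [hγ1, hyj]
      rcases hcases a ha with ⟨a, rfl, hya⟩ | ⟨a, rfl, hya⟩
      · rw [hya, hprojv, map_zero, zero_smul, add_zero]
        by_cases h0 : ⁅v j, v a⁆ = 0
        · rw [h0]
          exact zero_mem _
        have h1 := lie_mem_rootSpace (hv j) (hv a)
        have h2 : α j + α a ≠ 0 := by
          have := sum_posRoots_ne_zero ht hb {α j, α a} (Multiset.cons_ne_zero) (by
            simp [hpos])
          simpa using this
        have h3 := mem_posRoots_of_mem ht hb h2 h1 h0
          (b.lie_mem ((hpos j).2 (hv j)) ((hpos a).2 (hv a)))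
        rw [← hrange] at h3
        obtain ⟨i, hi⟩ := h3
        rw [← hi] at h1
        obtain ⟨c, hc⟩ := hspan1 i _ h1
        rw [← hc, ← hyv]
        exact Submodule.smul_mem _ _ (Submodule.subset_span
          ⟨i, hord i j _ (hpos a) hi.symm, rfl⟩)
      · rw [hya, hprojB, ← lie_skew, mem_rootSpace.1 (hv j) (B a), neg_add_cancel]
        exact zero_mem _
    · rw [hγ2 _ _ (Nat.le_add_right _ _), zero_smul, add_zero, hyj]
      rcases hcases a ha with ⟨a, rfl, hya⟩ | ⟨a, rfl, hya⟩
      · rw [hya, mem_rootSpace.1 (hv a) (B j), ← hya]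
        exact Submodule.smul_mem _ _ (Submodule.subset_span
          ⟨a, a.2.trans_le (Nat.le_add_right _ _), rfl⟩)
      · rw [hya, ht.lie_eq_zero _ (B j).2 _ (B a).2]
        exact zero_mem _
  · intro a ha
    have hρ : ∀ x, 2 * rho t b x = ∑ k, α k x := by
      intro x
      have hfin : (posRoots t b).Finite := (roots_finite ht).subset fun α h => h.1
      have h1 : ∑ᶠ β ∈ posRoots t b, β = ∑ k, α k := by
        rw [← hrange, finsum_mem_range hinj, finsum_eq_sum_of_fintype]
      rw [rho, h1, LinearMap.smul_apply, smul_eq_mul, mul_inv_cancel_left₀ two_ne_zero,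
        LinearMap.sum_apply]
    rw [hρ]
    -- For a root vector both sides vanish; for a Cartan element the indices from `N` on contribute
    -- weight zero, leaving the sum over all positive roots.
    rcases hcases a ha with ⟨a, rfl, hya⟩ | ⟨a, rfl, hya⟩
    · rw [hya, hprojv]
      simp only [map_zero, Finset.sum_const_zero]
      refine Finset.sum_eq_zero fun l hl => ?_
      have hl' : l < N := (Finset.mem_range.1 hl).trans a.2
      rw [show γ a l = _ from hγ1 a ⟨l, hl'⟩, hya, hprojv, map_zero]
    · rw [Finset.sum_range_add, Finset.sum_eq_zero (s := Finset.range a) fun l _ =>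
        hγ2 _ _ (Nat.le_add_right _ _), add_zero, Finset.sum_range]
      exact Finset.sum_congr rfl fun k _ => hγ1 _ k

end AdaptedBasis

end VermaDuality

end

noncomputable section

namespace VermaDuality

attribute [local instance 100] LieRing.ofAssociativeRing

/-! ### Characters of opposite algebras -/

section OppositeCharacter

open UniversalEnvelopingAlgebra

variable {k : Type*} [Field k]

theorem charIdeal_comp_surjective {A A' B : Type*} [Ring A] [Algebra k A] [Ring A'] [Algebra k A']
    [Ring B] [Algebra k B] (φ : A →ₐ[k] B) (χ : A →ₐ[k] k) (s : A' →ₐ[k] A)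
    (hs : Function.Surjective s) : charIdeal (φ.comp s) (χ.comp s) = charIdeal φ χ := by
  rw [charIdeal, charIdeal]
  congr 1
  exact hs.range_comp fun a => φ a - algebraMap k B (χ a)

theorem antipode_surjective (L : Type*) [LieRing L] [LieAlgebra k L] :
    Function.Surjective (antipode k L) := fun u =>
  ⟨(antipode k L u.unop).unop, congrArg MulOpposite.op (antipode_antipode u.unop)⟩

/-- Precomposing with the antipode, a surjection onto the opposite algebra, replaces the opposite of
`U(L)` by `U(L)` itself, where Lie algebra generators suffice; the generators change only by a sign.
-/
theorem mem_charIdeal_op_iff {L L' : Type*} [LieRing L] [LieAlgebra k L] [LieRing L']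
    [LieAlgebra k L'] (f : L →ₗ⁅k⁆ L') (χ : UniversalEnvelopingAlgebra k L →ₐ[k] k)
    (χ' : Module.Dual k L') {n : ℕ} {y : ℕ → L'} (w : Fin n → L)
    (hw : Submodule.span k (Set.range w) = ⊤) (hwy : ∀ j, f (w j) = y j)
    (hχ : ∀ j, χ (ι k (w j)) = χ' (y j)) (u : (UniversalEnvelopingAlgebra k L')ᵐᵒᵖ) :
    u ∈ charIdeal (AlgHom.op (envMap k f)) (χ.fromOpposite fun a b => Commute.all (χ a) (χ b)) ↔
      u.unop ∈ rightSpan (fun j => shiftedι χ' (y j)) n := by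
  rw [← charIdeal_comp_surjective _ _ (antipode k L) (antipode_surjective L),
    charIdeal_eq_span _ _ hw]
  have hgen : ∀ j, ((AlgHom.op (envMap k f)).comp (antipode k L)) (ι k (w j)) -
      algebraMap k _ (((χ.fromOpposite fun a b => Commute.all (χ a) (χ b)).comp (antipode k L))
        (ι k (w j))) = MulOpposite.op (-(shiftedι χ' (y j))) := by
    intro j
    have h1 : envMap k f (ι k (w j)) = ι k (y j) := by
      rw [← hwy]
      exact UniversalEnvelopingAlgebra.lift_ι_apply _ _ _
    rw [AlgHom.comp_apply, AlgHom.comp_apply, antipode_ι]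
    change MulOpposite.op (envMap k f (-(ι k (w j)))) - algebraMap k _ (χ (-(ι k (w j)))) = _
    rw [map_neg, map_neg, h1, hχ, shiftedι_apply, MulOpposite.algebraMap_apply,
      ← MulOpposite.op_sub, map_neg]
    congr 1
    abel
  simp only [hgen]
  constructor
  · intro hu
    induction hu using Submodule.span_induction with
    | mem u hu =>
      obtain ⟨j, rfl⟩ := hu
      exact neg_mem (mem_rightSpan (fun j => shiftedι χ' (y j)) j.2)
    | zero => exact zero_mem _
    | add u v _ _ hu hv => exact add_mem hu hv
    | smul a u _ hu => exact Submodule.smul_mem _ a hu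
  · intro hu
    rw [← MulOpposite.op_unop u]
    generalize u.unop = v at hu
    induction hu using Submodule.span_induction with
    | mem u hu =>
      obtain ⟨j, hj, rfl⟩ := hu
      have := neg_mem (Submodule.subset_span (R := (UniversalEnvelopingAlgebra k L')ᵐᵒᵖ)
        (Set.mem_range_self (f := fun j : Fin n => MulOpposite.op (-(shiftedι χ' (y j)))) ⟨j, hj⟩))
      rwa [← MulOpposite.op_neg, neg_neg] at this
    | zero => exact zero_mem _
    | add u v _ _ hu hv => exact add_mem hu hv
    | smul a u _ hu => exact Submodule.smul_mem _ a hu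

theorem charIdeal_envMap_eq_leftSpan {L L' : Type*} [LieRing L] [LieAlgebra k L] [LieRing L']
    [LieAlgebra k L'] (f : L →ₗ⁅k⁆ L') (χ : UniversalEnvelopingAlgebra k L →ₐ[k] k)
    (χ' : Module.Dual k L') {n : ℕ} {y : ℕ → L'} (w : Fin n → L)
    (hw : Submodule.span k (Set.range w) = ⊤) (hwy : ∀ j, f (w j) = y j)
    (hχ : ∀ j, χ (ι k (w j)) = χ' (y j)) :
    charIdeal (envMap k f) χ = leftSpan (fun j => shiftedι χ' (y j)) n := by
  rw [charIdeal_eq_span _ _ hw, leftSpan]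
  congr 1
  ext u
  have h1 : ∀ j, envMap k f (ι k (w j)) = ι k (y j) := fun j => by
    rw [← hwy]
    exact UniversalEnvelopingAlgebra.lift_ι_apply _ _ _
  constructor
  · rintro ⟨j, rfl⟩
    refine ⟨j, j.2, ?_⟩
    dsimp only
    rw [h1, hχ, shiftedι_apply]
  · rintro ⟨j, hj, rfl⟩
    refine ⟨⟨j, hj⟩, ?_⟩
    dsimp only
    rw [h1, hχ, shiftedι_apply]

end OppositeCharacter

/-! ### Invariance of the description of Ext under isomorphism -/

section Transport

open Abelian

universe u

variable {A : Type u} [Ring A]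

theorem DualCyclic.of_iso {M M' : ModuleCat.{u} A} {n : ℕ} {R : Submodule Aᵐᵒᵖ A}
    {D : (M ⟶ M) → A → Prop} (h : DualCyclic M n R D) (i : M' ≅ M) :
    (∀ j, j ≠ n → Subsingleton (Ext M' (ModuleCat.of A A) j)) ∧
    ∃ e : Ext M' (ModuleCat.of A A) n, (∀ ξ, ∃ a : A, MulOpposite.op a • e = ξ) ∧
      ∀ a : A, MulOpposite.op a • e = 0 ↔ a ∈ R := by
  have h1 : ∀ (j : ℕ) (ξ : Ext M' (ModuleCat.of A A) j),
      (Ext.mk₀ i.hom).comp ((Ext.mk₀ i.inv).comp ξ (zero_add j)) (zero_add j) = ξ := by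
    intro j ξ
    rw [Ext.mk₀_comp_mk₀_assoc, i.hom_inv_id, Ext.mk₀_id_comp]
  have h2 : ∀ (j : ℕ) (ξ : Ext M (ModuleCat.of A A) j),
      (Ext.mk₀ i.inv).comp ((Ext.mk₀ i.hom).comp ξ (zero_add j)) (zero_add j) = ξ := by
    intro j ξ
    rw [Ext.mk₀_comp_mk₀_assoc, i.inv_hom_id, Ext.mk₀_id_comp]
  have h3 : ∀ (j : ℕ) (a : A) (ξ : Ext M (ModuleCat.of A A) j),
      (Ext.mk₀ i.hom).comp (MulOpposite.op a • ξ) (zero_add j) =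
        MulOpposite.op a • (Ext.mk₀ i.hom).comp ξ (zero_add j) := fun j a ξ =>
    comp_op_smul_ext a _ ξ _
  obtain ⟨hv, e, he, hann, -⟩ := h
  refine ⟨fun j hj => ?_, (Ext.mk₀ i.hom).comp e (zero_add n), fun ξ => ?_, fun a => ?_⟩
  · have := hv j hj
    refine ⟨fun ξ η => ?_⟩
    rw [← h1 j ξ, ← h1 j η, Subsingleton.elim ((Ext.mk₀ i.inv).comp ξ (zero_add j))]
  · obtain ⟨a, ha⟩ := he ((Ext.mk₀ i.inv).comp ξ (zero_add n))
    exact ⟨a, by rw [← h3, ha, h1]⟩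
  · rw [← hann, ← h3]
    refine ⟨fun h => ?_, fun h => by rw [h, Ext.comp_zero]⟩
    rw [← h2 n (MulOpposite.op a • e), h, Ext.comp_zero]

end Transport

/-! ### Duality for Verma modules -/

section VermaDual

variable {F : Type*} {E : Type*} {g : Type*} [Field F] [CharZero F] [Field E] [Algebra F E]
  [LieRing g] [LieAlgebra F g] [FiniteDimensional F g] [LieAlgebra.HasCentralRadical F g]
  {t b : LieSubalgebra F g} (ht : IsSplittingCartan t) (hb : IsBorel t b)

/-- The functional on `g_E` which extends `μ ∈ t_E^*` by zero on the root spaces. -/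
def extendFunctional (μ : t →ₗ[F] E) : Module.Dual E (E ⊗[F] g) :=
  (μ ∘ₗ cartanProj ht).liftBaseChange E

omit [CharZero F] [FiniteDimensional F g] [LieAlgebra.HasCentralRadical F g] in
theorem extendFunctional_tmul (μ : t →ₗ[F] E) (x : g) :
    extendFunctional ht μ (1 ⊗ₜ x) = μ (cartanProj ht x) := by
  rw [extendFunctional, LinearMap.liftBaseChange_tmul, one_smul, LinearMap.comp_apply]

omit [CharZero F] [FiniteDimensional F g] [LieAlgebra.HasCentralRadical F g] in
theorem neg_extendFunctional (lam : t →ₗ[F] E) :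
    -(extendFunctional ht (lam + 2 • rhoE E t b)) =
      extendFunctional ht (-lam - 2 • rhoE E t b) := by
  ext x
  simp only [TensorProduct.AlgebraTensorModule.curry_apply, TensorProduct.curry_apply, LinearMap.neg_apply, LinearMap.coe_restrictScalars]
  rw [extendFunctional_tmul, extendFunctional_tmul]
  simp only [LinearMap.add_apply, LinearMap.sub_apply, LinearMap.neg_apply]
  abel

omit [CharZero F] [FiniteDimensional F g] [LieAlgebra.HasCentralRadical F g] in
theorem borelCharacter_ι (μ : t →ₗ[F] E) (x : b) :
    borelCharacter ht hb μ (UniversalEnvelopingAlgebra.ι E (1 ⊗ₜ x)) = μ (cartanProj ht x) := by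
  have := ht.isLieAbelian
  rw [borelCharacter, UniversalEnvelopingAlgebra.lift_ι_apply]
  change (μ.liftBaseChange E) ((borelToCartan ht hb : b →ₗ[F] t).baseChange E (1 ⊗ₜ x)) = _
  rw [LinearMap.baseChange_tmul, LinearMap.liftBaseChange_tmul, one_smul]
  rfl

/-- The form of the duality for Verma modules from which all the statements follow: `Ext` is
concentrated in degree `dim b`, where it is cyclic with explicit annihilator. -/
theorem exists_generator_ext_verma (lam : t →ₗ[F] E) :
    (∀ j, j ≠ Module.finrank F b → Subsingleton
      (Abelian.Ext (ModuleCat.of (U F g E) (Verma ht hb lam)) (ModuleCat.of _ (U F g E)) j)) ∧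
    ∃ e : Abelian.Ext (ModuleCat.of (U F g E) (Verma ht hb lam)) (ModuleCat.of _ (U F g E))
        (Module.finrank F b),
      (∀ ξ, ∃ a : U F g E, MulOpposite.op a • e = ξ) ∧
      (∀ a : (U F g E)ᵐᵒᵖ, a • e = 0 ↔ a ∈ charIdeal (AlgHom.op (inclU E b))
        ((borelCharacter ht hb (lam + 2 • rhoE E t b)).fromOpposite
          fun _ _ => Commute.all _ _)) ∧
      ∀ a : U F g E, antipode E (E ⊗[F] g) a • e = 0 ↔
        a ∈ charIdeal (inclU E b) (borelCharacter ht hb (-lam - 2 • rhoE E t b)) := by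
  obtain ⟨y, γ, hli, hspan, hcomm, htr⟩ := exists_adapted_basis ht hb
  set n := Module.finrank F b with hn
  have hyb : ∀ j : Fin n, y j ∈ b := fun j => by
    have : y j ∈ b.toSubmodule := hspan ▸ Submodule.subset_span ⟨j, j.2, rfl⟩
    exact this
  have hcharE : CharZero E := charZero_of_injective_algebraMap (algebraMap F E).injective
  let w : Fin n → E ⊗[F] b := fun j => 1 ⊗ₜ ⟨y j, hyb j⟩
  let Y : ℕ → E ⊗[F] g := fun j => 1 ⊗ₜ y j
  have hwY : ∀ j, lieBaseChange E b.incl (w j) = Y j := fun j => rfl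
  have hliY : LinearIndependent E fun i : Fin n => Y i :=
    Module.Flat.linearIndependent_one_tmul hli
  have hw : Submodule.span E (Set.range w) = ⊤ := by
    have h1 : Submodule.span F (Set.range fun j : Fin n => (⟨y j, hyb j⟩ : b)) = ⊤ := by
      refine LinearIndependent.span_eq_top_of_card_eq_finrank' ?_ (Fintype.card_fin _)
      exact LinearIndependent.of_comp b.toSubmodule.subtype hli
    have h2 := congrArg (Submodule.baseChange E) h1
    rw [Submodule.baseChange_span, Submodule.baseChange_top, ← Set.range_comp] at h2
    exact h2
  have hχ : ∀ (μ : t →ₗ[F] E) (j : Fin n), borelCharacter ht hb μ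
      (UniversalEnvelopingAlgebra.ι E (w j)) = extendFunctional ht μ (Y j) := fun μ j => by
    rw [borelCharacter_ι, extendFunctional_tmul]
  have hbr : ∀ (μ : t →ₗ[F] E), ∀ a < n, ∀ j < n, extendFunctional ht μ ⁅Y j, Y a⁆ = 0 := by
    intro μ a ha j hj
    rw [LieAlgebra.ExtendScalars.bracket_tmul, one_mul, extendFunctional_tmul,
      cartanProj_lie ht hb (hyb ⟨j, hj⟩) (hyb ⟨a, ha⟩), map_zero]
  have hcommY : ∀ a < n, ∀ j < n, ⁅Y j, Y a⁆ + (algebraMap F E (γ a j)) • Y j ∈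
      Submodule.span E (Y '' Set.Iio j) := by
    intro a ha j hj
    have h1 := Submodule.tmul_mem_baseChange_of_mem (1 : E) (hcomm a ha j hj)
    rw [Submodule.baseChange_span, ← Set.image_comp, TensorProduct.tmul_add,
      TensorProduct.tmul_smul] at h1
    rw [LieAlgebra.ExtendScalars.bracket_tmul, one_mul, algebraMap_smul]
    exact h1
  obtain ⟨D, hD⟩ := dualCyclic_enveloping (injective_ι_baseChange F g E) hliY hcommY (hbr lam)
    (hbr (lam + 2 • rhoE E t b)) (by
      intro a ha
      rw [extendFunctional_tmul, extendFunctional_tmul, LinearMap.add_apply, ← map_sum, htr a ha]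
      simp [rhoE, two_mul, two_smul])
  have hideal := charIdeal_envMap_eq_leftSpan _ (borelCharacter ht hb lam) _ w hw hwY (hχ lam)
  obtain ⟨h1, e, he, hann⟩ := hD.of_iso (M' := ModuleCat.of (U F g E) (Verma ht hb lam))
    (LinearEquiv.toModuleIso ((inducedCharEquiv _ _).trans (Submodule.quotEquivOfEq _ _ hideal)))
  refine ⟨h1, e, he, fun a => ?_, fun a => ?_⟩
  · exact (hann a.unop).trans (mem_charIdeal_op_iff _ _ _ w hw hwY (hχ _) a).symm
  -- Writing `λ + 2ρ` as the negative of `-λ - 2ρ` lets the antipode turn the right annihilator into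
  -- the left ideal that defines the second Verma module.
  · rw [← neg_neg (extendFunctional ht (lam + 2 • rhoE E t b)), neg_extendFunctional] at hann
    rw [show charIdeal (inclU E b) _ = _ from
      charIdeal_envMap_eq_leftSpan _ (borelCharacter ht hb (-lam - 2 • rhoE E t b)) _ w hw hwY
        (hχ _)]
    refine (hann _).trans (antipode_mem_rightSpan_iff.trans ?_)
    rw [neg_neg]

end VermaDual

end VermaDuality

end

theorem mainTheorem5 {p : ℕ} [Fact p.Prime]
    {F : Type*} [Field F] [Algebra ℚ_[p] F] [FiniteDimensional ℚ_[p] F]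
    {E : Type*} [Field E] [Algebra F E] [FiniteDimensional F E]
    {g : Type*} [LieRing g] [LieAlgebra F g] [FiniteDimensional F g]
    [LieAlgebra.HasCentralRadical F g]
    (t b : LieSubalgebra F g) (ht : IsSplittingCartan t) (hb : IsBorel t b)
    [HasDerivedCategory (ModuleCat (U F g E))]
    [HasDerivedCategory (ModuleCat (U F g E)ᵐᵒᵖ)]
    (lam : t →ₗ[F] E) :
    (∀ P : ProjectiveResolution (ModuleCat.of (U F g E) (Verma ht hb lam)),
      Nonempty (RHom P ≅
        ((DerivedCategory.singleFunctor _ 0).obj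
          (ModuleCat.of (U F g E)ᵐᵒᵖ (RightVerma ht hb (lam + 2 • rhoE E t b))))⟦
            -(Module.finrank F b : ℤ)⟧) ∧
      Nonempty ((leftOfRight E (E ⊗[F] g)).mapDerivedCategory.obj (RHom P) ≅
        ((DerivedCategory.singleFunctor _ 0).obj
          (ModuleCat.of (U F g E) (Verma ht hb (-lam - 2 • rhoE E t b))))⟦
            -(Module.finrank F b : ℤ)⟧)) ∧
    ∀ i : ℕ,
      (i = Module.finrank F b →
        Nonempty ((leftOfRight E (E ⊗[F] g)).obj
            (extRight (ModuleCat.of (U F g E) (Verma ht hb lam)) i) ≅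
          ModuleCat.of (U F g E) (Verma ht hb (-lam - 2 • rhoE E t b)))) ∧
      (i ≠ Module.finrank F b →
        Subsingleton (extRight (ModuleCat.of (U F g E) (Verma ht hb lam)) i)) := by
  have : CharZero F := charZero_of_injective_algebraMap (algebraMap ℚ_[p] F).injective
  obtain ⟨hvan, e, he, hann, hann'⟩ := exists_generator_ext_verma (E := E) ht hb lam
  obtain ⟨i₁⟩ := nonempty_inducedChar_equiv (X := extRight
    (ModuleCat.of (U F g E) (Verma ht hb lam)) (Module.finrank F b)) _ _ e
    (fun ξ => (he ξ).imp' MulOpposite.op fun _ h => h) hann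
  -- The same element `e` generates the left module, because the antipode is surjective.
  obtain ⟨i₂⟩ := nonempty_inducedChar_equiv (X := (leftOfRight E (E ⊗[F] g)).obj (extRight
    (ModuleCat.of (U F g E) (Verma ht hb lam)) (Module.finrank F b))) _ _ e
    (fun ξ => by
      obtain ⟨a, ha⟩ := he ξ
      obtain ⟨u, hu⟩ := antipode_surjective _ (MulOpposite.op a)
      refine ⟨u, ?_⟩
      rw [← hu] at ha
      exact ha) hann'
  have j₁ : extRight (ModuleCat.of (U F g E) (Verma ht hb lam)) (Module.finrank F b) ≅
      ModuleCat.of (U F g E)ᵐᵒᵖ (RightVerma ht hb (lam + 2 • rhoE E t b)) :=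
    LinearEquiv.toModuleIso i₁
  have j₂ : (leftOfRight E (E ⊗[F] g)).obj
      (extRight (ModuleCat.of (U F g E) (Verma ht hb lam)) (Module.finrank F b)) ≅
      ModuleCat.of (U F g E) (Verma ht hb (-lam - 2 • rhoE E t b)) :=
    LinearEquiv.toModuleIso i₂
  refine ⟨fun P => ?_, fun i => ⟨?_, fun hi => hvan i hi⟩⟩
  · obtain ⟨r⟩ := nonempty_rHom_iso_singleFunctor P (Module.finrank F b) hvan
    exact ⟨⟨r ≪≫ (DerivedCategory.singleFunctor _ _).mapIso j₁ ≪≫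
        ((DerivedCategory.singleFunctors _).shiftIso (-(Module.finrank F b : ℤ)) _ 0
          (neg_add_cancel _)).symm.app _⟩,
      ⟨(leftOfRight E (E ⊗[F] g)).mapDerivedCategory.mapIso r ≪≫
        ((leftOfRight E (E ⊗[F] g)).mapDerivedCategorySingleFunctor _).app _ ≪≫
        (DerivedCategory.singleFunctor _ _).mapIso j₂ ≪≫
        ((DerivedCategory.singleFunctors _).shiftIso (-(Module.finrank F b : ℤ)) _ 0
          (neg_add_cancel _)).symm.app _⟩⟩
  · rintro rfl
    exact ⟨j₂⟩
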